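/- Setting. Let $G>0$ and let $\mathcal I^+=\mathbb R\times S^2$ have coordinates $(u,\Omega)$. A quantum theory at future null infinity consists of a complex Hilbert space $H$ and three kinds of operator-valued distributions on $\mathcal I^+$, with a common dense invariant domain $D$: the Bondi mass aspect $m_B(u,\Omega)$, the shear $C_{AB}(u,\Omega)$ (symmetric, trace-free) and a family of massless matter fields $O_k(u,\Omega)$. Smearing with real test functions gives operators that are essentially self-adjoint on $D$. For $\chi\in C_c^\infty(\mathbb R)$ real put $M(\chi)=\int\chi(u)M(u)\,du$ with $M(u)=\int_{S^2}\sqrt\gamma\,m_B(u,\Omega)\,d^2\Omega$. The unitaries $e^{itM(\chi)}$ map $D$ to itself, and for $\psi\in D$ and $X$ any of the fields $C_{AB},O_k$ the vector $X(f)e^{itM(\chi)}\psi$ depends (sequentially) jointly continuously on the test function $f$ and on $t\in\mathbb R$. For an interval $I\subset\mathbb R$ let $\mathcal A(I)$ be the von Neumann algebra generated by (the closures of) all $m_B,C_{AB},O_k$ smeared with test functions supported in $I\times S^2$, and let $\mathcal R(I)$, $\mathcal M(I)$ be those generated by the $C_{AB},O_k$, respectively by the $O_k$, alone. Put $\mathcal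 A_{u_0,\epsilon}=\mathcal A((u_0,u_0+\epsilon))$. A (possibly unbounded) operator is called a function of the fields in $I$ if it is affiliated with the corresponding algebra. Assumptions. (i) Commutators. $[M(u),X(u',\Omega)]=-4\pi G i\,\theta(u'-u)\,\partial_{u'}X(u',\Omega)$ for $X=C_{AB},O_k$, up to corrections by local operators in the algebra at $u$. In smeared form: for all real $\chi\in C_c^\infty(\mathbb R)$ and test functions $f$, and every bounded open interval $I\supset\operatorname{supp}\chi$, the operator $$[M(\chi),X(f)]-4\pi G i\,X\big(\partial_{u}(v_\chi f)\big),\qquad v_\chi(u')=\int\chi(u)\,\theta(u'-u)\,du,$$ on $D$ is affiliated with $\mathcal A(I)$. (ii) Constraint. In the sense of distributions on $D$, $$\partial_u m_B=\tfrac14\,\partial_uD^AD^BC_{AB}-\tfrac18\,N_{AB}N^{AB}-4\pi G\,T_{uu}+L .$$ Here $N_{AB}=\partial_uC_{AB}$; the product $N_{AB}N^{AB}$ is defined by symmetrized point splitting and subtraction of $c$-numbers; $T_{uu}$ is a local function of the matter fields ($T_{uu}(h)$ is Hermitian and affiliated with $\mathcal M(I)$ whenever $\operatorname{supp}h\subset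 I\times S^2$); and $L$ is a local correction built from the radiative data ($L(h)$ is Hermitian and affiliated with $\mathcal R(I)$ whenever $\operatorname{supp}h\subset I\times S^2$). Conclusion. (a) Let $u_2<u_1$ and $\epsilon_1,\epsilon_2>0$ (in particular $\epsilon_1=\epsilon_2$). If two states (density matrices on $H$, in particular vector states) have different expectation values for some operator in $\mathcal A_{u_1,\epsilon_1}$, then they have different expectation values for some operator in $\mathcal A_{u_2,\epsilon_2}$. (b) Suppose in addition that the corrections in (i) are contact terms, i.e. that they vanish whenever $\operatorname{supp}\chi\subset(-\infty,c)$ and $\operatorname{supp}f\subset(c,\infty)\times S^2$ for some $c$. Then for all such $\chi,f$ with $\int\chi\,du=1$, all $U>0$, and $X=C_{AB},O_k$, one has on $D$ $$X(f_U)=e^{\,iM(\chi)U/4\pi G}\;X(f)\;e^{-iM(\chi)U/4\pi G},\qquad f_U(u,\Omega)=f(u-U,\Omega),$$ which is the smeared form of $X(u'+U,\Omega)=e^{iM(u_0)U/4\pi G}X(u',\Omega)e^{-iM(u_0)U/4\pi G}$ for $u'>u_0$, $U>0$. -/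

import Mathlib

open scoped ContDiff Manifold Topology InnerProductSpace
open MeasureTheory Filter

noncomputable section

namespace NullInfinity

/-! ## Future null infinity and test functions on it -/

/-- Euclidean three-space, in which the celestial sphere is embedded. -/
abbrev E3 := EuclideanSpace ℝ (Fin 3)

/-- The celestial sphere with its round unit metric. -/
abbrev S2 := Metric.sphere (0 : E3) 1

/-- Future null infinity `ℝ × S²`, with coordinates `(u, Ω)`. -/
abbrev Scri := ℝ × S2

/-- Radial projection to the unit sphere (with an arbitrary value at the origin). -/
def radial (x : E3) : S2 :=
  if h : x = 0 then ⟨EuclideanSpace.single 0 1, by simp⟩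
  else ⟨‖x‖⁻¹ • x, by simp [norm_smul, h]⟩

/-- The extension of a function on `ℝ × S²` to `ℝ × (ℝ³ ∖ {0})` that is constant along the rays. -/
def ext {V : Type*} (f : Scri → V) : ℝ × E3 → V := fun p => f (p.1, radial p.2)

/-- The set `ℝ × (ℝ³ ∖ {0})`. -/
def punctured : Set (ℝ × E3) := {p | p.2 ≠ 0}

theorem isOpen_punctured : IsOpen punctured :=
  isOpen_ne.preimage continuous_snd

theorem radial_coe (n : S2) : radial (n : E3) = n := by
  have h : (n : E3) ≠ 0 := ne_zero_of_mem_unit_sphere n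
  have h1 : ‖(n : E3)‖ = 1 := norm_eq_of_mem_sphere n
  ext1
  simp [radial, h, h1]

theorem ext_coe {V : Type*} (f : Scri → V) (p : Scri) : ext f (p.1, (p.2 : E3)) = f p := by
  simp [ext, radial_coe]

theorem coe_mem_punctured (p : Scri) : (p.1, (p.2 : E3)) ∈ punctured :=
  ne_zero_of_mem_unit_sphere p.2

theorem radial_val {x : E3} (h : x ≠ 0) : (radial x : E3) = ‖x‖⁻¹ • x := by
  simp [radial, h]

/-- A function on `ℝ × S²` is smooth. -/
def Smooth {V : Type*} [NormedAddCommGroup V] [NormedSpace ℝ V] (f : Scri → V) : Prop :=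
  ContMDiff ((𝓘(ℝ, ℝ)).prod (𝓡 2)) 𝓘(ℝ, V) ∞ f

theorem contMDiff_incl :
    ContMDiff ((𝓘(ℝ, ℝ)).prod (𝓡 2)) 𝓘(ℝ, ℝ × E3) ∞
      (fun p : Scri => ((p.1, (p.2 : E3)) : ℝ × E3)) := by
  have : Fact (Module.finrank ℝ E3 = 2 + 1) := ⟨by simp⟩
  rw [modelWithCornersSelf_prod, ← chartedSpaceSelf_prod]
  exact contMDiff_fst.prodMk (contMDiff_coe_sphere.comp contMDiff_snd)

theorem smooth_of_contDiffOn {V : Type*} [NormedAddCommGroup V] [NormedSpace ℝ V]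
    {f : Scri → V} {F : ℝ × E3 → V} (hF : ContDiffOn ℝ ∞ F punctured)
    (h : ∀ p : Scri, F (p.1, (p.2 : E3)) = f p) : Smooth f := by
  have h2 := hF.contMDiffOn.comp contMDiff_incl.contMDiffOn (s := Set.univ)
    (fun p _ => coe_mem_punctured p)
  have h3 : (F ∘ fun p : Scri => ((p.1, (p.2 : E3)) : ℝ × E3)) = f := funext h
  rw [h3] at h2
  exact contMDiffOn_univ.1 h2

theorem Smooth.contDiffOn_ext {V : Type*} [NormedAddCommGroup V] [NormedSpace ℝ V]
    {f : Scri → V} (hf : Smooth f) : ContDiffOn ℝ ∞ (ext f) punctured := by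
  have : Fact (Module.finrank ℝ E3 = 2 + 1) := ⟨by simp⟩
  let U : TopologicalSpace.Opens (ℝ × E3) := ⟨punctured, isOpen_punctured⟩
  have hval : ContMDiff 𝓘(ℝ, ℝ × E3) 𝓘(ℝ, ℝ × E3) ∞ (Subtype.val : U → ℝ × E3) :=
    contMDiff_subtype_val
  have h1 : ContMDiff 𝓘(ℝ, ℝ × E3) 𝓘(ℝ, ℝ) ∞ (fun p : U => p.1.1) :=
    contDiff_fst.contMDiff.comp hval
  have h2 : ContMDiff 𝓘(ℝ, ℝ × E3) 𝓘(ℝ, E3) ∞ (fun p : U => ‖p.1.2‖⁻¹ • p.1.2) := by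
    intro p
    have hp : p.1.2 ≠ 0 := p.2
    have : ContDiffAt ℝ ∞ (fun q : ℝ × E3 => ‖q.2‖⁻¹ • q.2) p.1 := by
      have hn : ContDiffAt ℝ ∞ (fun q : ℝ × E3 => ‖q.2‖) p.1 :=
        (contDiffAt_norm ℝ hp).comp p.1 contDiffAt_snd
      exact (hn.inv (norm_ne_zero_iff.2 hp)).smul contDiffAt_snd
    exact this.contMDiffAt.comp p (hval p)
  have h3 : ∀ p : U, ‖p.1.2‖⁻¹ • p.1.2 ∈ Metric.sphere (0 : E3) 1 := by
    intro p
    have hp : p.1.2 ≠ 0 := p.2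
    simp [norm_smul, hp]
  have h4 := hf.comp (h1.prodMk (ContMDiff.codRestrict_sphere (n := 2) h2 h3))
  intro p hp
  have h5 := h4 ⟨p, hp⟩
  have h6 : (f ∘ fun q : U => (q.1.1, Set.codRestrict
      (fun p : U => ‖p.1.2‖⁻¹ • p.1.2) _ h3 q)) = fun q : U => ext f q.1 := by
    funext q
    have hq : q.1.2 ≠ 0 := q.2
    simp only [Function.comp, ext]
    congr 2
    ext1
    simp [radial_val hq]
  rw [h6] at h5
  exact (contMDiffAt_subtype_iff (U := U) (f := ext f) (x := ⟨p, hp⟩)).1 h5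
    |>.contDiffAt.contDiffWithinAt

section TestFunctions

variable {V : Type*} [NormedAddCommGroup V] [NormedSpace ℝ V]

/-- Test sections over null infinity: smooth compactly supported functions `f` on `ℝ × S²` with
values in `V`, such that `f (u, Ω)` lies in the subspace `𝒱 Ω` of `V`. -/
def TestSec (𝒱 : S2 → Submodule ℝ V) : Submodule ℝ (Scri → V) where
  carrier := {f | Smooth f ∧ HasCompactSupport f ∧ ∀ p, f p ∈ 𝒱 p.2}
  zero_mem' := ⟨contMDiff_const, HasCompactSupport.zero, fun _ => zero_mem _⟩
  add_mem' := fun {f g} hf hg => by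
    refine ⟨?_, hf.2.1.add hg.2.1, fun p => add_mem (hf.2.2 p) (hg.2.2 p)⟩
    exact smooth_of_contDiffOn (hf.1.contDiffOn_ext.add hg.1.contDiffOn_ext)
      (fun p => by simp [ext_coe])
  smul_mem' := fun c f hf => by
    refine ⟨?_, hf.2.1.smul_left (f := fun _ => c), fun p => Submodule.smul_mem _ c (hf.2.2 p)⟩
    exact smooth_of_contDiffOn (hf.1.contDiffOn_ext.const_smul c) (fun p => by simp [ext_coe])

variable {𝒱 : S2 → Submodule ℝ V}

/-- The support of `f`, projected to the `u` axis, lies in the set `s`. -/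
def SuppIn (f : TestSec 𝒱) (s : Set ℝ) : Prop := tsupport f.1 ⊆ Prod.fst ⁻¹' s

theorem ext_eventuallyEq_zero {V : Type*} [NormedAddCommGroup V] {f : Scri → V} {p : Scri} (hp : p ∉ tsupport f) :
    ext f =ᶠ[𝓝 (p.1, (p.2 : E3))] 0 := by
  have hc : ContinuousAt (fun q : ℝ × E3 => (q.1, radial q.2)) (p.1, (p.2 : E3)) := by
    refine continuousAt_fst.prodMk ?_
    rw [Topology.IsInducing.subtypeVal.continuousAt_iff]
    have h0 : (p.2 : E3) ≠ 0 := coe_mem_punctured p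
    have h1 : ContinuousAt (fun q : ℝ × E3 => ‖q.2‖⁻¹ • q.2) (p.1, (p.2 : E3)) :=
      (continuousAt_snd.norm.inv₀ (norm_ne_zero_iff.2 h0)).smul continuousAt_snd
    refine h1.congr ?_
    filter_upwards [isOpen_punctured.mem_nhds (coe_mem_punctured p)] with q hq
    exact (radial_val hq).symm
  have hf : f =ᶠ[𝓝 p] 0 := notMem_tsupport_iff_eventuallyEq.1 hp
  have hc' : Tendsto (fun q : ℝ × E3 => (q.1, radial q.2)) (𝓝 (p.1, (p.2 : E3))) (𝓝 p) := by
    have := hc.tendsto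
    rwa [radial_coe] at this
  exact hc'.eventually hf

theorem contDiffOn_fderiv {W : Type*} [NormedAddCommGroup W] [NormedSpace ℝ W]
    {F : ℝ × E3 → W} (hF : ContDiffOn ℝ ∞ F punctured) :
    ContDiffOn ℝ ∞ (fderiv ℝ F) punctured :=
  hF.fderiv_of_isOpen isOpen_punctured (by simp)

/-- The derivative `∂f/∂u` of a test section. -/
def dU [FiniteDimensional ℝ V] : TestSec 𝒱 →ₗ[ℝ] TestSec 𝒱 where
  toFun f := ⟨fun p => deriv (fun s => f.1 (s, p.2)) p.1, by
    have key : ∀ p : Scri, HasDerivAt (fun s => f.1 (s, p.2))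
        (fderiv ℝ (ext f.1) (p.1, (p.2 : E3)) (1, 0)) p.1 := by
      intro p
      have h1 : HasFDerivAt (ext f.1) (fderiv ℝ (ext f.1) (p.1, (p.2 : E3)))
          (p.1, (p.2 : E3)) :=
        ((f.2.1.contDiffOn_ext.contDiffAt
          (isOpen_punctured.mem_nhds (coe_mem_punctured p))).differentiableAt
            (by simp)).hasFDerivAt
      have h2 : HasDerivAt (fun s : ℝ => (s, (p.2 : E3))) ((1 : ℝ), (0 : E3)) p.1 :=
        (hasDerivAt_id p.1).prodMk (hasDerivAt_const _ _)
      have h3 := h1.comp_hasDerivAt p.1 h2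
      refine h3.congr_of_eventuallyEq (Eventually.of_forall fun s => ?_)
      exact (ext_coe f.1 (s, p.2)).symm
    refine ⟨?_, ?_, ?_⟩
    · refine smooth_of_contDiffOn (F := fun q => fderiv ℝ (ext f.1) q (1, 0))
        ((contDiffOn_fderiv f.2.1.contDiffOn_ext).clm_apply contDiffOn_const) (fun p => ?_)
      exact (key p).deriv.symm
    · refine HasCompactSupport.intro f.2.2.1 (fun p hp => ?_)
      rw [(key p).deriv, (ext_eventuallyEq_zero hp).fderiv_eq]
      simp
    · intro p
      have h4 := range_deriv_subset_closure_span_image (fun s => f.1 (s, p.2)) dense_univ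
        (Set.mem_range_self p.1)
      have h5 : Submodule.span ℝ ((fun s => f.1 (s, p.2)) '' Set.univ) ≤ 𝒱 p.2 := by
        refine Submodule.span_le.2 ?_
        rintro _ ⟨s, -, rfl⟩
        exact f.2.2.2 (s, p.2)
      exact closure_minimal h5 (Submodule.closed_of_finiteDimensional _) h4⟩
  map_add' f g := by
    ext p
    have hd : ∀ h : TestSec 𝒱, DifferentiableAt ℝ (fun s => h.1 (s, p.2)) p.1 := by
      intro h
      have h1 := (h.2.1.contDiffOn_ext.contDiffAt
          (isOpen_punctured.mem_nhds (coe_mem_punctured p))).differentiableAt (by simp)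
      have h2 : DifferentiableAt ℝ (fun s : ℝ => (s, (p.2 : E3))) p.1 :=
        differentiableAt_id.prodMk (differentiableAt_const _)
      refine (h1.comp p.1 h2).congr_of_eventuallyEq (Eventually.of_forall fun s => ?_)
      exact (ext_coe h.1 (s, p.2)).symm
    exact deriv_add (hd f) (hd g)
  map_smul' c f := by
    ext p
    exact deriv_const_smul_field c (fun s => f.1 (s, p.2))

/-- The translate `(u, Ω) ↦ f (u - t, Ω)` of a test section towards the future. -/
def shift (t : ℝ) (f : TestSec 𝒱) : TestSec 𝒱 :=
  ⟨fun p => f.1 (p.1 - t, p.2), by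
    refine ⟨?_, ?_, fun p => f.2.2.2 (p.1 - t, p.2)⟩
    · refine smooth_of_contDiffOn (F := fun q => ext f.1 (q.1 - t, q.2)) ?_
        (fun p => ext_coe f.1 (p.1 - t, p.2))
      exact f.2.1.contDiffOn_ext.comp
        ((contDiff_fst.sub contDiff_const).prodMk contDiff_snd).contDiffOn (fun p hp => hp)
    · exact f.2.2.1.comp_homeomorph ((Homeomorph.subRight t).prodCongr (Homeomorph.refl S2))⟩

/-- Test functions of the retarded time `u` alone. -/
def TestLine : Submodule ℝ (ℝ → ℝ) where
  carrier := {χ | ContDiff ℝ ∞ χ ∧ HasCompactSupport χ}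
  zero_mem' := ⟨contDiff_const, HasCompactSupport.zero⟩
  add_mem' := fun hf hg => ⟨hf.1.add hg.1, hf.2.add hg.2⟩
  smul_mem' := fun c _ hf => ⟨hf.1.const_smul c, hf.2.smul_left (f := fun _ => c)⟩

/-- The function `u' ↦ ∫ χ(u) θ(u' - u) du`. -/
def smearedStep (χ : TestLine) (u' : ℝ) : ℝ := ∫ u in Set.Iic u', χ.1 u

theorem contDiff_smearedStep (χ : TestLine) : ContDiff ℝ ∞ (smearedStep χ) := by
  have hc : Continuous χ.1 := χ.2.1.continuous
  have hi : Integrable χ.1 := hc.integrable_of_hasCompactSupport χ.2.2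
  have hd : ∀ x, HasDerivAt (smearedStep χ) (χ.1 x) x := by
    intro x
    have h1 : smearedStep χ = fun y => (∫ u in Set.Iic (0 : ℝ), χ.1 u) + ∫ u in (0 : ℝ)..y, χ.1 u := by
      funext y
      rw [← intervalIntegral.integral_Iic_sub_Iic hi.integrableOn hi.integrableOn]
      simp [smearedStep]
    rw [h1]
    exact (intervalIntegral.integral_hasDerivAt_right hi.intervalIntegrable
      hc.stronglyMeasurable.stronglyMeasurableAtFilter hc.continuousAt).const_add _
  refine contDiff_infty_iff_deriv.2 ⟨fun x => (hd x).differentiableAt, ?_⟩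
  rw [show deriv (smearedStep χ) = χ.1 from funext fun x => (hd x).deriv]
  exact χ.2.1

/-- The product of a test section with the function `u' ↦ ∫ χ(u) θ(u' - u) du`. -/
def stepMul (χ : TestLine) (f : TestSec 𝒱) : TestSec 𝒱 :=
  ⟨fun p => smearedStep χ p.1 • f.1 p, by
    refine ⟨?_, ?_, fun p => Submodule.smul_mem _ _ (f.2.2.2 p)⟩
    · refine smooth_of_contDiffOn (F := fun q => smearedStep χ q.1 • ext f.1 q)
        (((contDiff_smearedStep χ).comp contDiff_fst).contDiffOn.smul f.2.1.contDiffOn_ext)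
        (fun p => by simp [ext_coe])
    · exact HasCompactSupport.smul_left f.2.2.1⟩

/-- Convergence of a sequence of test sections: the supports stay in a fixed compact set, and the
derivatives of each order converge uniformly. -/
def TestTendsto (f : ℕ → TestSec 𝒱) (g : TestSec 𝒱) : Prop :=
  (∃ K : Set Scri, IsCompact K ∧ ∀ n, tsupport (f n).1 ⊆ K) ∧
  ∀ k : ℕ, TendstoUniformlyOn (fun n q => iteratedFDeriv ℝ k (ext (f n).1) q)
    (iteratedFDeriv ℝ k (ext g.1)) atTop {q | ‖q.2‖ = 1}

end TestFunctions

/-- Real scalar test functions. -/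
abbrev TestScalar := TestSec (fun _ : S2 => (⊤ : Submodule ℝ ℝ))

/-- A function of `u` alone, as a test function on null infinity. -/
def ofLine (χ : TestLine) : TestScalar :=
  ⟨fun p => χ.1 p.1, by
    refine ⟨?_, ?_, fun p => Submodule.mem_top⟩
    · exact smooth_of_contDiffOn (F := fun q => χ.1 q.1)
        (χ.2.1.comp contDiff_fst).contDiffOn (fun p => rfl)
    · refine HasCompactSupport.intro (K := tsupport χ.1 ×ˢ Set.univ)
        (χ.2.2.isCompact.prod isCompact_univ) (fun p hp => ?_)
      refine image_eq_zero_of_notMem_tsupport (fun h => hp ⟨h, Set.mem_univ _⟩)⟩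

/-! ## Symmetric trace-free tensors on the sphere -/

/-- Symmetric trace-free tensors on the sphere at the point `n`, written as symmetric
endomorphisms of `ℝ³` of trace zero which annihilate the normal vector `n`. -/
def stf (n : S2) : Submodule ℝ (E3 →L[ℝ] E3) where
  carrier := {A | (∀ v w, ⟪A v, w⟫_ℝ = ⟪v, A w⟫_ℝ) ∧ A n = 0 ∧ LinearMap.trace ℝ E3 A = 0}
  zero_mem' := by simp
  add_mem' := fun {A B} hA hB => by
    refine ⟨fun v w => ?_, ?_, ?_⟩
    · simp [inner_add_left, inner_add_right, hA.1 v w, hB.1 v w]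
    · simp [hA.2.1, hB.2.1]
    · have hA3 := hA.2.2
      have hB3 := hB.2.2
      simp [hA3, hB3]
  smul_mem' := fun c A hA => by
    refine ⟨fun v w => ?_, ?_, ?_⟩
    · simp [inner_smul_left, inner_smul_right, hA.1 v w]
    · simp [hA.2.1]
    · have hA3 := hA.2.2
      simp [hA3]

/-- Test functions for the shear: compactly supported smooth symmetric trace-free tensors. -/
abbrev TestTensor := TestSec stf

/-- The contraction `S_{AB} T^{AB}`. -/
def contract (S T : E3 →L[ℝ] E3) : ℝ := LinearMap.trace ℝ E3 (S ∘L T)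

/-- The orthogonal projection to the tangent plane of the sphere at `n`. -/
def tangProj (n : E3) : E3 →L[ℝ] E3 :=
  ContinuousLinearMap.id ℝ E3 - (innerSL ℝ n).smulRight n

/-- The endomorphism `A` with `⟪A v, w⟫ = Q v w`. -/
def bilinToEnd (Q : E3 →L[ℝ] E3 →L[ℝ] ℝ) : E3 →L[ℝ] E3 :=
  ∑ i, (Q.flip (EuclideanSpace.single i 1)).smulRight (EuclideanSpace.single i 1)

/-- The derivative of a function on `ℝ × ℝ³` in the second variable. -/
def dX {W : Type*} [NormedAddCommGroup W] [NormedSpace ℝ W] (F : ℝ × E3 → W) :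
    ℝ × E3 → (E3 →L[ℝ] W) := fun q => (fderiv ℝ F q).comp (ContinuousLinearMap.inr ℝ ℝ E3)

/-- The covariant Hessian `D_A D_B h` on the unit sphere. Since `ext h` is constant along the rays,
this is the tangential part of its Euclidean Hessian. -/
def sphHess (h : Scri → ℝ) (p : Scri) : E3 →L[ℝ] E3 :=
  tangProj p.2 ∘L bilinToEnd (dX (dX (ext h)) (p.1, (p.2 : E3))) ∘L tangProj p.2

/-- The trace-free part `D_A D_B h - ½ γ_{AB} D² h` of the Hessian. -/
def sphHessTF (h : Scri → ℝ) (p : Scri) : E3 →L[ℝ] E3 :=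
  sphHess h p - ((1 / 2 : ℝ) * LinearMap.trace ℝ E3 (sphHess h p)) • tangProj p.2

theorem bilinToEnd_inner (Q : E3 →L[ℝ] E3 →L[ℝ] ℝ) (v w : E3) :
    ⟪bilinToEnd Q v, w⟫_ℝ = Q v w := by
  have hw : w = ∑ i, w i • EuclideanSpace.single i (1 : ℝ) := by
    ext j
    simp [Pi.single_apply]
  conv_rhs => rw [hw]
  simp [bilinToEnd, sum_inner, inner_smul_left, EuclideanSpace.inner_single_left, mul_comm]

theorem tangProj_inner (n v w : E3) : ⟪tangProj n v, w⟫_ℝ = ⟪v, tangProj n w⟫_ℝ := by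
  simp [tangProj, inner_sub_left, inner_sub_right, inner_smul_left, inner_smul_right,
    real_inner_comm, mul_comm]

theorem tangProj_self (n : S2) : tangProj n (n : E3) = 0 := by
  have h1 : ‖(n : E3)‖ = 1 := norm_eq_of_mem_sphere n
  simp [tangProj, h1]

theorem trace_tangProj (n : S2) : LinearMap.trace ℝ E3 (tangProj n) = 2 := by
  have h1 : ‖(n : E3)‖ = 1 := norm_eq_of_mem_sphere n
  have h2 : ((tangProj n : E3 →L[ℝ] E3) : E3 →ₗ[ℝ] E3) = LinearMap.id -
      ((innerSL ℝ (n : E3) : E3 →L[ℝ] ℝ) : E3 →ₗ[ℝ] ℝ).smulRight (n : E3) := by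
    ext v
    simp [tangProj]
  rw [h2, map_sub, LinearMap.trace_id, LinearMap.trace_smulRight]
  simp [h1]
  norm_num

theorem contDiffOn_dX {W : Type*} [NormedAddCommGroup W] [NormedSpace ℝ W]
    {F : ℝ × E3 → W} (hF : ContDiffOn ℝ ∞ F punctured) : ContDiffOn ℝ ∞ (dX F) punctured :=
  (contDiffOn_fderiv hF).clm_comp contDiffOn_const

theorem dX_dX_symm {h : Scri → ℝ} (hh : Smooth h) (p : Scri) (v w : E3) :
    dX (dX (ext h)) (p.1, (p.2 : E3)) v w = dX (dX (ext h)) (p.1, (p.2 : E3)) w v := by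
  have hn := isOpen_punctured.mem_nhds (coe_mem_punctured p)
  have h1 : ContDiffAt ℝ ∞ (ext h) (p.1, (p.2 : E3)) := hh.contDiffOn_ext.contDiffAt hn
  have h2 : DifferentiableAt ℝ (fderiv ℝ (ext h)) (p.1, (p.2 : E3)) :=
    ((contDiffOn_fderiv hh.contDiffOn_ext).contDiffAt hn).differentiableAt (by simp)
  have h3 : ∀ v w, dX (dX (ext h)) (p.1, (p.2 : E3)) v w =
      fderiv ℝ (fderiv ℝ (ext h)) (p.1, (p.2 : E3)) (0, v) (0, w) := by
    intro v w
    have h4 : HasFDerivAt (dX (ext h)) _ (p.1, (p.2 : E3)) :=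
      (((ContinuousLinearMap.compL ℝ E3 (ℝ × E3) ℝ).flip
        (ContinuousLinearMap.inr ℝ ℝ E3)).hasFDerivAt).comp _ h2.hasFDerivAt
    simp only [dX] at h4 ⊢
    rw [h4.fderiv]
    simp
  rw [h3, h3]
  exact (h1.isSymmSndFDerivAt (by simpa using (WithTop.coe_le_coe.2 (le_top : (2 : ℕ∞) ≤ ⊤)))).eq _ _

/-- The trace-free Hessian `(D_A D_B h)^TF` of a scalar test function, as a test tensor. -/
def hessTF (h : TestScalar) : TestTensor :=
  ⟨sphHessTF h.1, by
    have hP : ContDiffOn ℝ ∞ (fun q : ℝ × E3 => tangProj q.2) punctured := by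
      have h1 : ContDiff ℝ ∞ (fun q : ℝ × E3 => tangProj q.2) := by
        unfold tangProj
        exact contDiff_const.sub (((innerSL ℝ).contDiff.comp contDiff_snd).smulRight contDiff_snd)
      exact h1.contDiffOn
    have hB : ContDiff ℝ ∞ bilinToEnd := by
      unfold bilinToEnd
      refine ContDiff.sum fun i _ => ?_
      refine ContDiff.smulRight ?_ contDiff_const
      exact ((ContinuousLinearMap.flipₗᵢ ℝ E3 E3 ℝ).toContinuousLinearEquiv.toContinuousLinearMap.contDiff
        (E := E3 →L[ℝ] E3 →L[ℝ] ℝ) (F := E3 →L[ℝ] E3 →L[ℝ] ℝ)).clm_apply contDiff_const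
    have hT : ContDiff ℝ ∞ (fun A : E3 →L[ℝ] E3 => LinearMap.trace ℝ E3 A) := by
      have : IsLinearMap ℝ (fun A : E3 →L[ℝ] E3 => LinearMap.trace ℝ E3 A) :=
        ⟨fun A B => by simp, fun c A => by simp⟩
      exact (LinearMap.toContinuousLinearMap this.mk').contDiff
    have hH : ContDiffOn ℝ ∞ (fun q : ℝ × E3 =>
        tangProj q.2 ∘L bilinToEnd (dX (dX (ext h.1)) q) ∘L tangProj q.2) punctured :=
      hP.clm_comp ((hB.comp_contDiffOn
        (contDiffOn_dX (contDiffOn_dX h.2.1.contDiffOn_ext))).clm_comp hP)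
    refine ⟨?_, ?_, fun p => ⟨fun v w => ?_, ?_, ?_⟩⟩
    · exact smooth_of_contDiffOn
        (hH.sub ((contDiffOn_const.mul (hT.comp_contDiffOn hH)).smul hP)) (fun p => rfl)
    · refine HasCompactSupport.intro h.2.2.1 (fun p hp => ?_)
      have h1 : dX (ext h.1) =ᶠ[𝓝 (p.1, (p.2 : E3))] 0 := by
        filter_upwards [(ext_eventuallyEq_zero hp).fderiv (𝕜 := ℝ)] with q hq
        rw [dX, hq]
        simp
      have h2 : dX (dX (ext h.1)) (p.1, (p.2 : E3)) = 0 := by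
        have h3 := h1.fderiv_eq (𝕜 := ℝ)
        rw [dX, h3]
        simp
      have h4 : sphHess h.1 p = 0 := by
        ext v i
        simp [sphHess, h2, bilinToEnd]
      rw [sphHessTF, h4]
      ext v i
      simp
    · have hs : ⟪sphHess h.1 p v, w⟫_ℝ = ⟪v, sphHess h.1 p w⟫_ℝ := by
        simp only [sphHess, ContinuousLinearMap.comp_apply]
        rw [tangProj_inner, bilinToEnd_inner, dX_dX_symm h.2.1, ← tangProj_inner,
          real_inner_comm, bilinToEnd_inner]
      simp only [sphHessTF, sub_apply, smul_apply,
        inner_sub_left, inner_sub_right, inner_smul_left, inner_smul_right, hs, tangProj_inner]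
      simp
    · simp [sphHessTF, sphHess, tangProj_self]
    · have := trace_tangProj p.2
      simp only [sphHessTF, ContinuousLinearMap.toLinearMap_sub,
        ContinuousLinearMap.toLinearMap_smul, map_sub, map_smul, this, smul_eq_mul]
      ring⟩

/-! ## Operators on a common domain -/

section Operators

variable {H : Type*} [NormedAddCommGroup H] [InnerProductSpace ℂ H] [CompleteSpace H]
variable {D : Submodule ℂ H}

/-- An endomorphism of the subspace `D`, as an unbounded operator on `H` with domain `D`. -/
def toPMap (A : Module.End ℂ D) : H →ₗ.[ℂ] H := ⟨D, D.subtype ∘ₗ A⟩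

/-- `A` is symmetric on `D`. -/
def IsHermitian (A : Module.End ℂ D) : Prop :=
  ∀ φ ψ : D, ⟪(A φ : H), (ψ : H)⟫_ℂ = ⟪(φ : H), (A ψ : H)⟫_ℂ

/-- `A` is essentially self-adjoint on `D`. -/
def IsEssSelfAdjoint (A : Module.End ℂ D) : Prop :=
  IsHermitian A ∧ IsSelfAdjoint (toPMap A).closure

/-- The bounded operator `B` satisfies `B Ā ⊆ Ā B`, where `Ā` is the closure of `A`. -/
def CommutesWith (B : H →L[ℂ] H) (A : Module.End ℂ D) : Prop :=
  ∀ x ∈ (toPMap A).graph.topologicalClosure,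
    (B x.1, B x.2) ∈ (toPMap A).graph.topologicalClosure

/-- The commutant of a set of unbounded operators: the bounded operators which commute with the
closures of all of them, together with their adjoints. -/
def commutant (𝒢 : Set (Module.End ℂ D)) : Set (H →L[ℂ] H) :=
  {B | ∀ A ∈ 𝒢, CommutesWith B A ∧ CommutesWith (star B) A}

theorem star_commutant (𝒢 : Set (Module.End ℂ D)) : star (commutant 𝒢) = commutant 𝒢 := by
  ext B
  simp only [Set.mem_star, commutant, Set.mem_ofPred_eq, star_star]
  exact forall₂_congr fun A _ => and_comm

/-- The von Neumann algebra generated by a set of (essentially self-adjoint) operators. It contains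
all bounded functions of these operators, in particular their spectral projections. -/
def generatedAlgebra (𝒢 : Set (Module.End ℂ D)) : VonNeumannAlgebra H where
  toStarSubalgebra := StarSubalgebra.centralizer ℂ (commutant 𝒢)
  centralizer_centralizer' := by
    change Set.centralizer (Set.centralizer
      (StarSubalgebra.centralizer ℂ (commutant 𝒢) : Set (H →L[ℂ] H))) =
      (StarSubalgebra.centralizer ℂ (commutant 𝒢) : Set (H →L[ℂ] H))
    rw [StarSubalgebra.coe_centralizer, Set.centralizer_centralizer_centralizer]

/-- The operator `A` is affiliated with the von Neumann algebra generated by `𝒢`, that is, it is a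
(possibly unbounded) function of the operators in `𝒢`. -/
def IsAffiliated (𝒢 : Set (Module.End ℂ D)) (A : Module.End ℂ D) : Prop :=
  ∀ B ∈ commutant 𝒢, CommutesWith B A

/-- `W t = exp (i t A)`: a strongly continuous one-parameter unitary group whose generator
extends `A`. -/
structure IsExponential (A : Module.End ℂ D) (W : ℝ → (H ≃ₗᵢ[ℂ] H)) : Prop where
  add : ∀ s t ψ, W (s + t) ψ = W s (W t ψ)
  continuous : ∀ ψ, Continuous fun t => W t ψ
  hasDerivAt : ∀ ψ : D, HasDerivAt (fun t => W t (ψ : H)) (Complex.I • (A ψ : H)) 0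

end Operators

/-! ## States -/

/-- A (normal) state, given by a density matrix `∑ₙ |ψₙ⟩⟨ψₙ|` of trace one. -/
structure State (H : Type*) [NormedAddCommGroup H] where
  vec : ℕ → H
  trace_one : HasSum (fun n => ‖vec n‖ ^ 2) 1

/-- The expectation value of a bounded operator in a state. -/
def State.expect {H : Type*} [NormedAddCommGroup H] [InnerProductSpace ℂ H]
    (ρ : State H) (A : H →L[ℂ] H) : ℂ := ∑' n, ⟪ρ.vec n, A (ρ.vec n)⟫_ℂ

/-- Some operator of the algebra has different expectation values in the two states. -/
def Distinguishable {H : Type*} [NormedAddCommGroup H] [InnerProductSpace ℂ H] [CompleteSpace H]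
    (𝒜 : VonNeumannAlgebra H) (ρ σ : State H) : Prop :=
  ∃ A ∈ 𝒜, ρ.expect A ≠ σ.expect A

/-! ## Quantum theories at null infinity -/

/-- The asymptotic data of a quantum theory of gravity at future null infinity: a Hilbert space `H`
and operator-valued distributions on null infinity, defined on a common dense invariant domain.
They are the Bondi mass aspect `m_B`, the shear `C_AB`, and the radiative data of a family of
massless matter fields. Test functions are real, and smeared fields are essentially self-adjoint
observables. The integrated Bondi mass `M`, smeared in `u`, generates a unitary
group that preserves the domain and acts on it continuously. -/
structure AsymptoticTheory (H : Type*) [NormedAddCommGroup H] [InnerProductSpace ℂ H]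
    [CompleteSpace H] (ι : Type*) where
  D : Submodule ℂ H
  dense : Dense (D : Set H)
  /-- `mB h = ∫ √γ m_B(u, Ω) h(u, Ω) du d²Ω` -/
  mB : TestScalar →ₗ[ℝ] Module.End ℂ D
  /-- `C f = ∫ √γ C_AB(u, Ω) f^AB(u, Ω) du d²Ω` -/
  C : TestTensor →ₗ[ℝ] Module.End ℂ D
  /-- `O k h = ∫ √γ O_k(u, Ω) h(u, Ω) du d²Ω` -/
  O : ι → TestScalar →ₗ[ℝ] Module.End ℂ D
  mB_selfAdjoint : ∀ h, IsEssSelfAdjoint (mB h)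
  C_selfAdjoint : ∀ f, IsEssSelfAdjoint (C f)
  O_selfAdjoint : ∀ k h, IsEssSelfAdjoint (O k h)
  mB_continuous : ∀ (h : ℕ → TestScalar) (h₀ : TestScalar), TestTendsto h h₀ →
    ∀ ψ : D, Tendsto (fun n => (mB (h n) ψ : H)) atTop (𝓝 (mB h₀ ψ : H))
  exp_mass : ∀ χ : TestLine, ∃ W : ℝ → (H ≃ₗᵢ[ℂ] H), IsExponential (mB (ofLine χ)) W ∧
    ∃ hW : ∀ (t : ℝ) (ψ : D), W t ψ ∈ D,
      (∀ (f : ℕ → TestTensor) (f₀ : TestTensor) (t : ℕ → ℝ) (t₀ : ℝ),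
        TestTendsto f f₀ → Tendsto t atTop (𝓝 t₀) → ∀ ψ : D,
          Tendsto (fun n => (C (f n) ⟨W (t n) ψ, hW (t n) ψ⟩ : H)) atTop
            (𝓝 (C f₀ ⟨W t₀ ψ, hW t₀ ψ⟩ : H))) ∧
      ∀ (k : ι) (h : ℕ → TestScalar) (h₀ : TestScalar) (t : ℕ → ℝ) (t₀ : ℝ),
        TestTendsto h h₀ → Tendsto t atTop (𝓝 t₀) → ∀ ψ : D,
          Tendsto (fun n => (O k (h n) ⟨W (t n) ψ, hW (t n) ψ⟩ : H)) atTop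
            (𝓝 (O k h₀ ⟨W t₀ ψ, hW t₀ ψ⟩ : H))

namespace AsymptoticTheory

variable {H : Type*} [NormedAddCommGroup H] [InnerProductSpace ℂ H] [CompleteSpace H]
  {ι : Type*} (T : AsymptoticTheory H ι)

/-- The smeared Bondi mass `M(χ) = ∫ χ(u) M(u) du`, where `M(u) = ∫ √γ m_B(u, Ω) d²Ω`. -/
def mass (χ : TestLine) : Module.End ℂ T.D := T.mB (ofLine χ)

/-- The news `N_AB = ∂_u C_AB`, smeared with a test tensor. -/
def news (f : TestTensor) : Module.End ℂ T.D := -T.C (dU f)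

/-- The matter fields with `u` coordinate in `(a, b)`. -/
def matterFields (a b : ℝ) : Set (Module.End ℂ T.D) :=
  {A | ∃ k h, SuppIn h (Set.Ioo a b) ∧ A = T.O k h}

/-- The radiative data (shear and matter fields) with `u` coordinate in `(a, b)`. -/
def radiativeFields (a b : ℝ) : Set (Module.End ℂ T.D) :=
  {A | ∃ f, SuppIn f (Set.Ioo a b) ∧ A = T.C f} ∪ T.matterFields a b

/-- All asymptotic fields, including the Bondi mass aspect, with `u` coordinate in `(a, b)`. -/
def allFields (a b : ℝ) : Set (Module.End ℂ T.D) :=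
  {A | ∃ h, SuppIn h (Set.Ioo a b) ∧ A = T.mB h} ∪ T.radiativeFields a b

/-- The algebra `𝒜_{u₀,ε}` associated with an `ε`-neighbourhood of the cut `u₀`. -/
def cutAlgebra (u₀ ε : ℝ) : VonNeumannAlgebra H := generatedAlgebra (T.allFields u₀ (u₀ + ε))

/-- The difference between `[M(χ), X(f)]` and `4πGi X(∂_u (v f))`, `v(u') = ∫ χ(u) θ(u' - u) du`.
The latter is the smeared form of `-4πGi ∂_{u'}X(u', Ω) θ(u' - u)`. -/
def commutatorCorrection {V : Type*} [NormedAddCommGroup V] [NormedSpace ℝ V]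
    [FiniteDimensional ℝ V] {𝒱 : S2 → Submodule ℝ V}
    (G : ℝ) (X : TestSec 𝒱 →ₗ[ℝ] Module.End ℂ T.D) (χ : TestLine) (f : TestSec 𝒱) :
    Module.End ℂ T.D :=
  ⁅T.mass χ, X f⁆ - ((4 * Real.pi * G : ℝ) * Complex.I) • X (dU (stepMul χ f))

/-- The commutators `[M(u), X(u', Ω)] = -4πGi ∂_{u'}X(u', Ω) θ(u' - u)` of the Bondi mass with
the shear and the matter fields hold up to corrections by local operators in the algebra at `u`. -/
def MassCommutators (G : ℝ) : Prop :=
  ∀ (χ : TestLine) (a b : ℝ), tsupport χ.1 ⊆ Set.Ioo a b →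
    (∀ f, IsAffiliated (T.allFields a b) (T.commutatorCorrection G T.C χ f)) ∧
    ∀ k h, IsAffiliated (T.allFields a b) (T.commutatorCorrection G (T.O k) χ h)

/-- The corrections to these commutators are contact terms, without effect on fields in
the future of the cut at which the mass is evaluated. -/
def ContactCorrections (G : ℝ) : Prop :=
  ∀ (χ : TestLine) (c : ℝ), tsupport χ.1 ⊆ Set.Iio c →
    (∀ f, SuppIn f (Set.Ioi c) → T.commutatorCorrection G T.C χ f = 0) ∧
    ∀ k h, SuppIn h (Set.Ioi c) → T.commutatorCorrection G (T.O k) χ h = 0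

/-- `Q` is the square `N_AB N^AB` of the news, defined by point splitting and subtraction of
`c`-numbers: `Q(h)` is the weak limit of symmetrized sums `∑ N(f)N(g) - c`, where the kernels
`∑ f ⊗ g` converge to the kernel `h(x) δ(x, y)` and are supported in any prescribed interval of `u`
that contains the support of `h`. -/
def IsNewsSquare (Q : TestScalar →ₗ[ℝ] Module.End ℂ T.D) : Prop :=
  ∀ (h : TestScalar) (a b : ℝ), SuppIn h (Set.Ioo a b) →
    ∃ (m : ℕ → ℕ) (f g : ℕ → ℕ → TestTensor) (c : ℕ → ℝ),
      (∀ n i, SuppIn (f n i) (Set.Ioo a b) ∧ SuppIn (g n i) (Set.Ioo a b)) ∧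
      (∀ s t : TestTensor, Tendsto (fun n => ∑ i ∈ Finset.range (m n),
          (∫ p, contract ((f n i).1 p) (s.1 p) ∂(volume.prod (volume : Measure E3).toSphere)) *
          ∫ p, contract ((g n i).1 p) (t.1 p) ∂(volume.prod (volume : Measure E3).toSphere)) atTop
        (𝓝 (∫ p, h.1 p * contract (s.1 p) (t.1 p)
          ∂(volume.prod (volume : Measure E3).toSphere)))) ∧
      ∀ (η : H) (ψ : T.D), Tendsto (fun n => ⟪η, (((∑ i ∈ Finset.range (m n), (1 / 2 : ℂ) •
          (T.news (f n i) * T.news (g n i) + T.news (g n i) * T.news (f n i))) ψ : T.D) : H) -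
            (c n : ℂ) • (ψ : H)⟫_ℂ) atTop (𝓝 ⟪η, (Q h ψ : H)⟫_ℂ)

/-- The Hermitian operator-valued distribution `L` is local with respect to a net of fields: smeared
with `h` it is a function of the fields in any interval of `u` which contains the support. -/
def IsLocalOperator (fields : ℝ → ℝ → Set (Module.End ℂ T.D))
    (L : TestScalar →ₗ[ℝ] Module.End ℂ T.D) : Prop :=
  ∀ h, IsHermitian (L h) ∧ ∀ a b, SuppIn h (Set.Ioo a b) → IsAffiliated (fields a b) (L h)

/-- The evolution equation
`∂_u m_B = ¼ ∂_u D^A D^B C_AB - ⅛ N_AB N^AB - 4πG T_uu`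
of the Bondi mass aspect, smeared with test functions, where `T_uu` is a local function of the
matter fields, holds up to corrections by local operators `L` built from the radiative data. -/
def MassConstraint (G : ℝ) : Prop :=
  ∃ NN Tuu L : TestScalar →ₗ[ℝ] Module.End ℂ T.D,
    T.IsNewsSquare NN ∧ T.IsLocalOperator T.matterFields Tuu ∧
    T.IsLocalOperator T.radiativeFields L ∧
    ∀ h : TestScalar, -T.mB (dU h) =
      -((1 / 4 : ℝ) • T.C (hessTF (dU h))) - (1 / 8 : ℝ) • NN h -
        (4 * Real.pi * G) • Tuu h + L h

/-- `Y = exp(iM(χ)U/4πG) X exp(-iM(χ)U/4πG)` on the domain. -/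
def IsMassConjugate (G : ℝ) (χ : TestLine) (U : ℝ) (X Y : Module.End ℂ T.D) : Prop :=
  ∀ W : ℝ → (H ≃ₗᵢ[ℂ] H), IsExponential (T.mass χ) W →
    ∃ hW : ∀ (t : ℝ) (ψ : T.D), W t ψ ∈ T.D, ∀ ψ : T.D,
      (Y ψ : H) = W (U / (4 * Real.pi * G))
        (X ⟨W (-U / (4 * Real.pi * G)) ψ, hW _ ψ⟩ : T.D)

end AsymptoticTheory

end NullInfinity

end

/-!
The algebra of a cut contains the fields at all later cuts because the Bondi mass moves them there.
Write `κ = 4πG`, and let `χ` have unit mass and support in `(a, c)`, with `a < c < b`. To the future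
of `c` the smeared step function of `χ` is `1`, so the commutator hypothesis reads
`[M(χ), X(f)] = iκ X(∂_u f) + K` with `K` affiliated with the fields in `(a, b)`
(`AsymptoticTheory.motionGenerator_mass`). Hence `exp (-i t M(χ)) X(f_t) exp (i t M(χ))`, where
`f_t` is `f` translated by `κ t`, has the derivative `-i K` conjugated by the group. If a bounded
operator `B` commutes with all fields in `(a, b)`, then it commutes with `M(χ)` and `K`, so the
matrix elements of its commutator with `X(f_t)` between the vectors `exp (i t M(χ)) φ` and
`exp (i t M(χ)) ψ` do not depend on `t` (`JointlyContinuous.weaklyCommutes_of_shift`). A short piece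
of `f` can be translated by a fixed amount to the past without reaching the support of `χ`; with a
cutoff in `u` and induction over the extent of the support, commutation spreads from `(a, b)` to all
of `(a, ∞)` (`of_suppIn_Ioi`). No transport equation has to be solved, since only rigid translations
occur.

For the mass aspect the constraint expresses `∂_u m_B` through radiative data. An operator that
commutes with these commutes with `∂_u m_B`
(`AsymptoticTheory.MassConstraint.weaklyCommutes_mB_dU`), and the same argument, with
translations alone, yields `m_B` (`AsymptoticTheory.weaklyCommutes_mB`). So the commutant of the fields in `(a, b)` is contained in
that of the fields in any later interval (`AsymptoticTheory.commutant_allFields_subset`), and the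
algebra of the later interval is contained in that of `(a, b)`.

If the corrections are contact terms, then `K = 0` and `exp (-i t M(χ)) X(f_t) exp (i t M(χ))` is
constant, which is the translation formula (`JointlyContinuous.shift_apply_eq`).

Two points make this work for unbounded operators. Since smeared fields are essentially
self-adjoint, commutation with their closures is equivalent to commutation of matrix elements on the
domain (`WeaklyCommutes.commutesWith`), which is stable under sums, products and weak limits. And
`X(f) exp (i t M) ψ` is differentiable in norm, as joint continuity makes its weak derivative
continuous (`JointlyContinuous.hasDerivAt_apply`).
-/

/-! ### Weak commutation with operators on a common domain -/

namespace NullInfinity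

section Operators

variable {H : Type*} [NormedAddCommGroup H] [InnerProductSpace ℂ H]
variable {D : Submodule ℂ H}

/-- The bounded operator `B` commutes with `A` in the sense of matrix elements on `D`; for
Hermitian `A` this says that `B` maps `D` into the domain of `A†` and intertwines `A` with `A†`. -/
def WeaklyCommutes (B : H →L[ℂ] H) (A : Module.End ℂ D) : Prop :=
  ∀ φ ψ : D, ⟪(A φ : H), B ψ⟫_ℂ = ⟪(φ : H), B (A ψ)⟫_ℂ

theorem mem_graph_toPMap (A : Module.End ℂ D) (ψ : D) :
    ((ψ : H), (A ψ : H)) ∈ (toPMap A).graph := by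
  rw [LinearPMap.mem_graph_iff]
  exact ⟨ψ, rfl, rfl⟩

/-- A relation `⟪u, x⟫ = ⟪v, y⟫` that holds on the graph of `A` extends to its closure. -/
theorem inner_eq_of_mem_closure_graph {A : Module.End ℂ D} {u v : H}
    (h : ∀ ψ : D, ⟪u, (ψ : H)⟫_ℂ = ⟪v, (A ψ : H)⟫_ℂ) {x : H × H}
    (hx : x ∈ (toPMap A).graph.topologicalClosure) : ⟪u, x.1⟫_ℂ = ⟪v, x.2⟫_ℂ := by
  have hc : IsClosed {x : H × H | ⟪u, x.1⟫_ℂ = ⟪v, x.2⟫_ℂ} :=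
    isClosed_eq (by fun_prop) (by fun_prop)
  refine closure_minimal ?_ hc hx
  rintro ⟨y, z⟩ hy
  obtain ⟨ψ, rfl, rfl⟩ := (LinearPMap.mem_graph_iff _).1 hy
  exact h ψ

/-- Strong commutation implies weak commutation, for an operator `A` with formal adjoint `A'`. -/
theorem CommutesWith.inner_eq {B : H →L[ℂ] H} {A A' : Module.End ℂ D} (hB : CommutesWith B A)
    (hA : ∀ φ ψ : D, ⟪(A' φ : H), (ψ : H)⟫_ℂ = ⟪(φ : H), (A ψ : H)⟫_ℂ) (φ ψ : D) :
    ⟪(A' φ : H), B ψ⟫_ℂ = ⟪(φ : H), B (A ψ)⟫_ℂ :=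
  inner_eq_of_mem_closure_graph (hA φ)
    (hB _ (Submodule.le_topologicalClosure _ (mem_graph_toPMap A ψ)))

theorem CommutesWith.weaklyCommutes {B : H →L[ℂ] H} {A : Module.End ℂ D} (hB : CommutesWith B A)
    (hA : IsHermitian A) : WeaklyCommutes B A :=
  hB.inner_eq hA

/-- The closure of an essentially self-adjoint operator equals the adjoint, so weak commutation
already gives commutation with the closure. -/
theorem WeaklyCommutes.commutesWith [CompleteSpace H] (hD : Dense (D : Set H)) {B : H →L[ℂ] H}
    {A : Module.End ℂ D} (hB : WeaklyCommutes B A) (hA : IsEssSelfAdjoint A) :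
    CommutesWith B A := by
  have hcl : (toPMap A).IsClosable := by
    have hle : toPMap A ≤ (toPMap A).adjoint :=
      LinearPMap.IsFormalAdjoint.le_adjoint hD fun φ ψ => hA.1 φ ψ
    exact (LinearPMap.adjoint_isClosed hD).isClosable.leIsClosable hle
  intro x hx
  rw [hcl.graph_closure_eq_closure_graph, ← LinearPMap.isSelfAdjoint_def.1 hA.2,
    LinearPMap.adjoint_graph_eq_graph_adjoint hA.2.dense_domain, Submodule.mem_adjoint_iff]
  intro y z hyz
  rw [← hcl.graph_closure_eq_closure_graph] at hyz
  rw [sub_eq_zero]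
  simp only [← ContinuousLinearMap.adjoint_inner_left B]
  refine inner_eq_of_mem_closure_graph (fun ψ => ?_) hx
  simp only [ContinuousLinearMap.adjoint_inner_left]
  have h := inner_eq_of_mem_closure_graph (A := A) (u := B (A ψ)) (v := B ψ) (fun φ => ?_) hyz
  · rw [← inner_conj_symm, ← h, inner_conj_symm]
  · rw [← inner_conj_symm, ← hB φ ψ, inner_conj_symm]

theorem WeaklyCommutes.star_left [CompleteSpace H] {B : H →L[ℂ] H} {A : Module.End ℂ D}
    (hB : WeaklyCommutes B A) : WeaklyCommutes (star B) A := by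
  intro φ ψ
  rw [ContinuousLinearMap.star_eq_adjoint, ContinuousLinearMap.adjoint_inner_right,
    ContinuousLinearMap.adjoint_inner_right, ← inner_conj_symm, ← hB ψ φ, inner_conj_symm]

theorem WeaklyCommutes.add {B : H →L[ℂ] H} {A A' : Module.End ℂ D} (h : WeaklyCommutes B A)
    (h' : WeaklyCommutes B A') : WeaklyCommutes B (A + A') := by
  intro φ ψ
  simp only [LinearMap.add_apply, Submodule.coe_add, map_add, inner_add_left, inner_add_right,
    h φ ψ, h' φ ψ]

theorem WeaklyCommutes.real_smul {B : H →L[ℂ] H} {A : Module.End ℂ D} (h : WeaklyCommutes B A)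
    (c : ℝ) : WeaklyCommutes B (c • A) := by
  intro φ ψ
  have h2 : ∀ η : D, (((c • A) η : D) : H) = (c : ℂ) • (A η : H) := fun η => by
    simp [Complex.coe_smul]
  rw [h2, h2, map_smul, inner_smul_left, inner_smul_right, h φ ψ]
  simp

theorem WeaklyCommutes.neg {B : H →L[ℂ] H} {A : Module.End ℂ D} (h : WeaklyCommutes B A) :
    WeaklyCommutes B (-A) := by
  intro φ ψ
  simp [h φ ψ]

theorem WeaklyCommutes.sub {B : H →L[ℂ] H} {A A' : Module.End ℂ D} (h : WeaklyCommutes B A)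
    (h' : WeaklyCommutes B A') : WeaklyCommutes B (A - A') := by
  rw [sub_eq_add_neg]
  exact h.add h'.neg

theorem mem_commutant_iff [CompleteSpace H] (hD : Dense (D : Set H)) {𝒢 : Set (Module.End ℂ D)}
    (h𝒢 : ∀ A ∈ 𝒢, IsEssSelfAdjoint A) {B : H →L[ℂ] H} :
    B ∈ commutant 𝒢 ↔ ∀ A ∈ 𝒢, WeaklyCommutes B A :=
  ⟨fun h A hA => (h A hA).1.weaklyCommutes (h𝒢 A hA).1, fun h A hA =>
    ⟨(h A hA).commutesWith hD (h𝒢 A hA), (h A hA).star_left.commutesWith hD (h𝒢 A hA)⟩⟩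

theorem generatedAlgebra_mono [CompleteSpace H] {𝒢 𝒢' : Set (Module.End ℂ D)}
    (h : commutant 𝒢' ⊆ commutant 𝒢)
    {A : H →L[ℂ] H} (hA : A ∈ generatedAlgebra 𝒢) : A ∈ generatedAlgebra 𝒢' :=
  StarSubalgebra.centralizer_le ℂ _ _ h hA

/-- Weak limits of sums of symmetrized products, up to real multiples of the identity, inherit weak
commutation from the factors. -/
theorem WeaklyCommutes.of_tendsto_symmetrized [CompleteSpace H] {B : H →L[ℂ] H}
    {Q : Module.End ℂ D} {m : ℕ → ℕ} {X Y : ℕ → ℕ → Module.End ℂ D} {c : ℕ → ℝ}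
    (hBX : ∀ n i, WeaklyCommutes B (X n i)) (hBY : ∀ n i, WeaklyCommutes B (Y n i))
    (hQ : ∀ (η : H) (ψ : D), Tendsto (fun n => ⟪η, (((∑ i ∈ Finset.range (m n), (1 / 2 : ℂ) •
          (X n i * Y n i + Y n i * X n i)) ψ : D) : H) - (c n : ℂ) • (ψ : H)⟫_ℂ) atTop
            (𝓝 ⟪η, (Q ψ : H)⟫_ℂ)) : WeaklyCommutes B Q := by
  intro φ ψ
  have h1 := hQ (star B φ) ψ
  have h2 := (hQ (B ψ) φ).star
  simp only [RCLike.star_def, inner_conj_symm] at h2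
  rw [ContinuousLinearMap.star_eq_adjoint] at h1
  simp only [ContinuousLinearMap.adjoint_inner_left] at h1
  refine tendsto_nhds_unique h2 (h1.congr fun n => ?_)
  -- For products the order is reversed on one side, because `D` is invariant; symmetrization
  -- makes both sides equal.
  have hprod : ∀ X Y : Module.End ℂ D, WeaklyCommutes B X →
      WeaklyCommutes B Y → ⟪((Y (X φ) : D) : H), B ψ⟫_ℂ = ⟪(φ : H), B (X (Y ψ))⟫_ℂ :=
    fun X Y hX hY => by rw [hY, hX]
  have hBc : B ((c n : ℂ) • (ψ : H)) = (c n : ℂ) • B ψ := map_smul _ _ _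
  rw [map_sub, inner_sub_left, inner_sub_right, hBc, inner_smul_left, inner_smul_right,
    Complex.conj_ofReal]
  congr 1
  simp only [LinearMap.sum_apply, Submodule.coe_sum, map_sum, sum_inner, inner_sum]
  refine Finset.sum_congr rfl fun i _ => ?_
  simp only [LinearMap.smul_apply, LinearMap.add_apply, Module.End.mul_apply, Submodule.coe_smul,
    Submodule.coe_add, map_smul, map_add, inner_smul_left, inner_smul_right, inner_add_left,
    inner_add_right]
  rw [hprod _ _ (hBX n i) (hBY n i), hprod _ _ (hBY n i) (hBX n i)]
  have h2 : (starRingEnd ℂ) (1 / 2) = 1 / 2 := by simp [map_ofNat]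
  rw [h2]
  ring

end Operators

end NullInfinity

/-! ### Supports of test sections -/

namespace NullInfinity

section TestFunctions

variable {V : Type*} [NormedAddCommGroup V] [NormedSpace ℝ V] {𝒱 : S2 → Submodule ℝ V}

theorem tsupport_subset_of_eq_zero {W W' : Type*} [Zero W] [Zero W'] {f : Scri → W}
    {g : Scri → W'}
    (h : ∀ p ∉ tsupport f, g p = 0) : tsupport g ⊆ tsupport f :=
  closure_minimal (fun _ hp => by_contra fun hf => hp (h _ hf)) (isClosed_tsupport f)

theorem SuppIn.mono {f : TestSec 𝒱} {s t : Set ℝ} (hf : SuppIn f s) (hst : s ⊆ t) :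
    SuppIn f t :=
  hf.trans (Set.preimage_mono hst)

theorem tsupport_dU_subset [FiniteDimensional ℝ V] (f : TestSec 𝒱) :
    tsupport (dU f).1 ⊆ tsupport f.1 := by
  refine tsupport_subset_of_eq_zero fun p hp => ?_
  have h : ContinuousAt (fun s : ℝ => ((s, p.2) : Scri)) p.1 := by fun_prop
  have h0 : (fun s : ℝ => f.1 (s, p.2)) =ᶠ[𝓝 p.1] fun _ => 0 :=
    h.eventually (notMem_tsupport_iff_eventuallyEq.1 hp)
  exact h0.deriv_eq.trans (deriv_const _ _)

theorem SuppIn.dU [FiniteDimensional ℝ V] {f : TestSec 𝒱} {s : Set ℝ} (hf : SuppIn f s) :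
    SuppIn (dU f) s :=
  (tsupport_dU_subset f).trans hf

theorem tsupport_hessTF_subset (h : TestScalar) : tsupport (hessTF h).1 ⊆ tsupport h.1 := by
  refine tsupport_subset_of_eq_zero fun p hp => ?_
  have h1 : dX (ext h.1) =ᶠ[𝓝 (p.1, (p.2 : E3))] fun _ => 0 := by
    filter_upwards [(ext_eventuallyEq_zero hp).fderiv (𝕜 := ℝ)] with q hq
    rw [dX, hq]
    simp
  have h2 : dX (dX (ext h.1)) (p.1, (p.2 : E3)) = 0 := by
    rw [dX, h1.fderiv_eq (𝕜 := ℝ)]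
    simp
  have h3 : sphHess h.1 p = 0 := by
    ext v i
    simp [sphHess, h2, bilinToEnd]
  change sphHessTF h.1 p = 0
  rw [sphHessTF, h3]
  ext v i
  simp

theorem SuppIn.hessTF {h : TestScalar} {s : Set ℝ} (hh : SuppIn h s) : SuppIn (hessTF h) s :=
  (tsupport_hessTF_subset h).trans hh

theorem tsupport_shift (t : ℝ) (f : TestSec 𝒱) :
    tsupport (shift t f).1 = (fun p : Scri => (p.1 - t, p.2)) ⁻¹' tsupport f.1 :=
  tsupport_comp_eq_preimage f.1
    ((Homeomorph.subRight t).prodCongr (Homeomorph.refl S2))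

theorem SuppIn.shift {f : TestSec 𝒱} {s s' : Set ℝ} (hf : SuppIn f s) {t : ℝ}
    (h : ∀ u, u - t ∈ s → u ∈ s') : SuppIn (shift t f) s' := by
  intro p hp
  rw [tsupport_shift] at hp
  exact h _ (hf hp)

theorem shift_zero (f : TestSec 𝒱) : shift 0 f = f := by
  ext p
  simp [shift]

theorem shift_shift (s t : ℝ) (f : TestSec 𝒱) : shift s (shift t f) = shift (t + s) f := by
  ext p
  simp [shift, sub_sub, add_comm]

/-- If the unit mass of `χ` lies before the support of `f`, the smeared step function is `1` on
that support. -/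
theorem stepMul_eq_self {χ : TestLine} {c : ℝ} (hχ : (∫ u, χ.1 u) = 1)
    (hc : tsupport χ.1 ⊆ Set.Iio c) {f : TestSec 𝒱} (hf : SuppIn f (Set.Ioi c)) :
    stepMul χ f = f := by
  ext p
  change smearedStep χ p.1 • f.1 p = f.1 p
  by_cases hp : p ∈ tsupport f.1
  · have h1 : smearedStep χ p.1 = 1 := by
      rw [smearedStep, setIntegral_eq_integral_of_forall_compl_eq_zero, hχ]
      intro u hu
      refine image_eq_zero_of_notMem_tsupport fun h => hu ?_
      have h1 : u < c := hc h
      have h2 : c < p.1 := hf hp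
      exact (h1.trans h2).le
    rw [h1, one_smul]
  · rw [image_eq_zero_of_notMem_tsupport hp, smul_zero]

/-- The product of a test section with a smooth function of `u`. -/
noncomputable def lineMul (ρ : ℝ → ℝ) (hρ : ContDiff ℝ ∞ ρ) (f : TestSec 𝒱) : TestSec 𝒱 :=
  ⟨fun p => ρ p.1 • f.1 p, by
    refine ⟨?_, HasCompactSupport.smul_left f.2.2.1,
      fun p => Submodule.smul_mem _ _ (f.2.2.2 p)⟩
    exact smooth_of_contDiffOn (F := fun q => ρ q.1 • ext f.1 q)
      ((hρ.comp contDiff_fst).contDiffOn.smul f.2.1.contDiffOn_ext) (fun p => by simp [ext_coe])⟩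

theorem SuppIn.lineMul {f : TestSec 𝒱} {s s' : Set ℝ} (hf : SuppIn f s) {ρ : ℝ → ℝ}
    (hρ : ContDiff ℝ ∞ ρ) {A : Set ℝ} (hA : IsClosed A) (h0 : ∀ u ∉ A, ρ u = 0)
    (hs : s ∩ A ⊆ s') : SuppIn (lineMul ρ hρ f) s' := by
  have h1 : tsupport (NullInfinity.lineMul ρ hρ f).1 ⊆ tsupport f.1 ∩ Prod.fst ⁻¹' A := by
    refine closure_minimal (fun p hp => ?_)
      ((isClosed_tsupport f.1).inter (hA.preimage continuous_fst))
    have hp' : ρ p.1 • f.1 p ≠ 0 := hp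
    refine ⟨by_contra fun h => hp' ?_, by_contra fun h => hp' ?_⟩
    · rw [image_eq_zero_of_notMem_tsupport h, smul_zero]
    · rw [h0 _ h, zero_smul]
  exact fun p hp => hs ⟨hf (h1 hp).1, (h1 hp).2⟩

theorem SuppIn.exists_subset_Iio {f : TestSec 𝒱} {s : Set ℝ} (hf : SuppIn f s) :
    ∃ T : ℝ, SuppIn f (s ∩ Set.Iio T) := by
  obtain ⟨T, hT⟩ := (f.2.2.1.isCompact.image continuous_fst).bddAbove
  exact ⟨T + 1, fun p hp => ⟨hf hp,
    (hT (Set.mem_image_of_mem _ hp)).trans_lt (lt_add_one T)⟩⟩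

/-! ### Difference quotients of translations -/

theorem infty_add_natCast_le (k : ℕ) : (∞ : ℕ∞ω) + k ≤ ∞ := by
  exact_mod_cast le_top

/-- A directional derivative commutes with iterated derivatives, by the symmetry of second
derivatives. -/
theorem fderiv_iteratedFDeriv_apply {E W : Type*} [NormedAddCommGroup E] [NormedSpace ℝ E]
    [NormedAddCommGroup W] [NormedSpace ℝ W] {F : E → W} {s : Set E} (hs : IsOpen s)
    (hF : ContDiffOn ℝ ∞ F s) (e : E) (k : ℕ) {q : E} (hq : q ∈ s) :
    fderiv ℝ (iteratedFDeriv ℝ k F) q e = iteratedFDeriv ℝ k (fun x => fderiv ℝ F x e) q := by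
  have hsm : ∀ k : ℕ, ∀ x ∈ s, ContDiffAt ℝ ∞ (iteratedFDeriv ℝ k F) x := fun k x hx =>
    (hF.contDiffAt (hs.mem_nhds hx)).iteratedFDeriv_right (infty_add_natCast_le k)
  induction k generalizing q with
  | zero =>
    ext m
    rw [iteratedFDeriv_zero_eq_comp]
    simp [LinearIsometryEquiv.comp_fderiv]
  | succ k ih =>
    have h1 : (fun x => fderiv ℝ (iteratedFDeriv ℝ k F) x e) =ᶠ[𝓝 q]
        iteratedFDeriv ℝ k (fun x => fderiv ℝ F x e) := by
      filter_upwards [hs.mem_nhds hq] with x hx using ih hx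
    have h2 : DifferentiableAt ℝ (fderiv ℝ (iteratedFDeriv ℝ k F)) q :=
      ((hsm k q hq).fderiv_right (infty_add_natCast_le 1)).differentiableAt (by simp)
    have h3 : ∀ v w, fderiv ℝ (fun x => fderiv ℝ (iteratedFDeriv ℝ k F) x w) q v =
        fderiv ℝ (fderiv ℝ (iteratedFDeriv ℝ k F)) q v w := by
      intro v w
      rw [fderiv_clm_apply h2 (differentiableAt_const _)]
      simp
    have h4 := ((hsm k q hq).isSymmSndFDerivAt (by
        simpa using (WithTop.coe_le_coe.2 (le_top : (2 : ℕ∞) ≤ ⊤)))).eq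
    have h5 : DifferentiableAt ℝ (iteratedFDeriv ℝ (k + 1) F) q :=
      (hsm (k + 1) q hq).differentiableAt (by simp)
    ext m
    rw [← fderiv_continuousMultilinear_apply_const_apply h5, iteratedFDeriv_succ_apply_left,
      ← h1.fderiv_eq, h3, ← h4, ← h3]
    simp only [iteratedFDeriv_succ_apply_left]
    exact fderiv_continuousMultilinear_apply_const_apply
      (h2.clm_apply (differentiableAt_const _)) _ _

theorem ext_dU_eq [FiniteDimensional ℝ V] (f : TestSec 𝒱) {q : ℝ × E3} (hq : q ∈ punctured) :
    ext (dU f).1 q = fderiv ℝ (ext f.1) q (1, 0) := by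
  have h1 : HasFDerivAt (ext f.1) (fderiv ℝ (ext f.1) q) (q.1, q.2) :=
    ((f.2.1.contDiffOn_ext.contDiffAt (isOpen_punctured.mem_nhds hq)).differentiableAt
      (by simp)).hasFDerivAt
  have h2 : HasDerivAt (fun s : ℝ => (s, q.2)) ((1 : ℝ), (0 : E3)) q.1 :=
    (hasDerivAt_id q.1).prodMk (hasDerivAt_const _ _)
  exact (h1.comp_hasDerivAt q.1 h2).deriv

theorem sub_mem_punctured {q : ℝ × E3} (hq : q ∈ punctured) (r : ℝ) :
    q - (r, 0) ∈ punctured := by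
  simpa [punctured] using hq

theorem hasDerivAt_iteratedFDeriv_ext [FiniteDimensional ℝ V] (f : TestSec 𝒱) (k : ℕ)
    {q : ℝ × E3} (hq : q ∈ punctured) (r : ℝ) :
    HasDerivAt (fun r : ℝ => iteratedFDeriv ℝ k (ext f.1) (q - (r, 0)))
      (-iteratedFDeriv ℝ k (ext (dU f).1) (q - (r, 0))) r := by
  have hr := sub_mem_punctured hq r
  have h1 : HasFDerivAt (iteratedFDeriv ℝ k (ext f.1))
      (fderiv ℝ (iteratedFDeriv ℝ k (ext f.1)) (q - (r, 0))) (q - (r, 0)) :=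
    (((f.2.1.contDiffOn_ext.contDiffAt (isOpen_punctured.mem_nhds hr)).iteratedFDeriv_right
      (infty_add_natCast_le k)).differentiableAt (by simp)).hasFDerivAt
  have h2 : HasDerivAt (fun r : ℝ => q - (r, (0 : E3))) (-((1 : ℝ), (0 : E3))) r :=
    ((hasDerivAt_id r).prodMk (hasDerivAt_const _ _)).const_sub q
  have h3 := h1.comp_hasDerivAt r h2
  have h4 : ext (dU f).1 =ᶠ[𝓝 (q - (r, 0))] fun x => fderiv ℝ (ext f.1) x (1, 0) := by
    filter_upwards [isOpen_punctured.mem_nhds hr] with x hx using ext_dU_eq f hx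
  have h5 : iteratedFDeriv ℝ k (ext (dU f).1) (q - (r, 0)) =
      iteratedFDeriv ℝ k (fun x => fderiv ℝ (ext f.1) x (1, 0)) (q - (r, 0)) :=
    (h4.iteratedFDeriv ℝ k).eq_of_nhds
  rw [h5, ← fderiv_iteratedFDeriv_apply isOpen_punctured f.2.1.contDiffOn_ext _ _ hr, ← map_neg]
  exact h3

/-- Each derivative of a test section is uniformly continuous along the `u` axis. -/
theorem exists_iteratedFDeriv_ext_sub_lt (f : TestSec 𝒱) (k : ℕ) {ε : ℝ} (hε : 0 < ε) :
    ∃ δ > 0, ∀ q : ℝ × E3, ‖q.2‖ = 1 → ∀ r : ℝ, |r| < δ →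
      ‖iteratedFDeriv ℝ k (ext f.1) (q - (r, 0)) - iteratedFDeriv ℝ k (ext f.1) q‖ < ε := by
  let g : Scri → (ℝ × E3) [×k]→L[ℝ] V :=
    fun p => iteratedFDeriv ℝ k (ext f.1) (p.1, (p.2 : E3))
  have hg : Continuous g := by
    rw [continuous_iff_continuousAt]
    intro p
    have h1 : ContinuousAt (iteratedFDeriv ℝ k (ext f.1)) (p.1, (p.2 : E3)) :=
      ((f.2.1.contDiffOn_ext.contDiffAt
        (isOpen_punctured.mem_nhds (coe_mem_punctured p))).iteratedFDeriv_right
          (infty_add_natCast_le k)).continuousAt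
    exact h1.comp (f := fun p : Scri => (p.1, (p.2 : E3))) (by fun_prop)
  have hs : HasCompactSupport g := by
    refine HasCompactSupport.intro f.2.2.1 fun p hp => ?_
    have h1 := ((ext_eventuallyEq_zero hp).iteratedFDeriv ℝ k).eq_of_nhds
    exact h1.trans (by simp)
  obtain ⟨δ, hδ, h⟩ := Metric.uniformContinuous_iff.1
    (hs.uniformContinuous_of_continuous hg) ε hε
  refine ⟨δ, hδ, fun q hq r hr => ?_⟩
  have hq' : q.2 ∈ Metric.sphere (0 : E3) 1 := by simpa using hq
  have h1 := @h (q.1 - r, ⟨q.2, hq'⟩) (q.1, ⟨q.2, hq'⟩)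
    (by simpa [Prod.dist_eq, Real.dist_eq] using hr)
  rw [dist_eq_norm] at h1
  have h2 : q - (r, (0 : E3)) = (q.1 - r, q.2) := by ext <;> simp
  rw [h2]
  exact h1

theorem testTendsto_const (f : TestSec 𝒱) : TestTendsto (fun _ : ℕ => f) f := by
  refine ⟨⟨tsupport f.1, f.2.2.1, fun _ => le_rfl⟩, fun k => ?_⟩
  rw [Metric.tendstoUniformlyOn_iff]
  intro ε hε
  exact Eventually.of_forall fun _ q _ => by simpa using hε

/-- The difference quotients of the translations of a test section converge, together with all
derivatives, by the mean value inequality. -/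
theorem testTendsto_slope_shift [FiniteDimensional ℝ V] (f : TestSec 𝒱) {s : ℕ → ℝ}
    (hs : Tendsto s atTop (𝓝 0)) (hs0 : ∀ᶠ n in atTop, s n ≠ 0) :
    TestTendsto (fun n => (s n)⁻¹ • (shift (s n) f - f)) (-dU f) := by
  constructor
  · obtain ⟨R, hR⟩ := isBounded_iff_forall_norm_le.1 (Metric.isBounded_range_of_tendsto s hs)
    let K : Set Scri := (fun x : ℝ × Scri => (x.2.1 + x.1, x.2.2)) ''
      (Set.Icc (-R) R ×ˢ tsupport f.1)
    have hR0 : 0 ≤ R := (norm_nonneg _).trans (hR (s 0) (Set.mem_range_self 0))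
    refine ⟨K, ?_, fun n => ?_⟩
    · exact (isCompact_Icc.prod f.2.2.1).image (by fun_prop)
    · have hK : IsClosed K := ((isCompact_Icc.prod f.2.2.1).image (by fun_prop)).isClosed
      refine closure_minimal (fun p hp => ?_) hK
      by_contra hpK
      have h1 : f.1 p = 0 := by
        refine image_eq_zero_of_notMem_tsupport fun h => hpK ?_
        exact ⟨(0, p), ⟨by simpa using hR0, h⟩, by simp⟩
      have h2 : f.1 (p.1 - s n, p.2) = 0 := by
        refine image_eq_zero_of_notMem_tsupport fun h => hpK ?_
        exact ⟨(s n, (p.1 - s n, p.2)), ⟨abs_le.1 (hR _ (Set.mem_range_self n)), h⟩, by simp⟩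
      refine hp ?_
      change (s n)⁻¹ • (f.1 (p.1 - s n, p.2) - f.1 p) = 0
      rw [h1, h2, sub_zero, smul_zero]
  · intro k
    rw [Metric.tendstoUniformlyOn_iff]
    intro ε hε
    obtain ⟨δ, hδ, h⟩ := exists_iteratedFDeriv_ext_sub_lt (dU f) k (half_pos hε)
    filter_upwards [Metric.tendsto_nhds.1 hs δ hδ, hs0] with n hn hn0 q hq
    have hq0 : q ∈ punctured := by
      intro h0
      simp [h0] at hq
    rw [Real.dist_eq, sub_zero] at hn
    have hF : ContDiffAt ℝ k (ext f.1) q :=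
      (f.2.1.contDiffOn_ext.contDiffAt (isOpen_punctured.mem_nhds hq0)).of_le (by
        norm_cast; exact le_top)
    have hF' : ContDiffAt ℝ k (fun x => ext f.1 (x - (s n, 0))) q := by
      refine ContDiffAt.comp (g := ext f.1) q ?_ (by fun_prop)
      exact (f.2.1.contDiffOn_ext.contDiffAt
        (isOpen_punctured.mem_nhds (sub_mem_punctured hq0 _))).of_le (by norm_cast; exact le_top)
    have e1 : ext ((s n)⁻¹ • (shift (s n) f - f)).1 =
        (s n)⁻¹ • ((fun x => ext f.1 (x - (s n, 0))) - ext f.1) := by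
      funext x
      simp [ext, shift]
    have e2 : ext (-dU f).1 = -ext (dU f).1 := rfl
    have hsub : ContDiffAt ℝ k ((fun x => ext f.1 (x - (s n, 0))) - ext f.1) q := hF'.sub hF
    rw [e1, e2, iteratedFDeriv_const_smul_apply hsub, iteratedFDeriv_sub_apply hF' hF,
      iteratedFDeriv_comp_sub, iteratedFDeriv_neg_apply]
    set Φ := iteratedFDeriv ℝ k (ext f.1)
    set Ψ := iteratedFDeriv ℝ k (ext (dU f).1)
    -- Mean value inequality for `r ↦ Φ (q - r e) + r Ψ q`, `e` the unit vector of the `u` axis.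
    have hmv := Convex.norm_image_sub_le_of_norm_hasDerivWithin_le
      (f := fun r : ℝ => Φ (q - (r, 0)) + r • Ψ q)
      (f' := fun r => -Ψ (q - (r, 0)) + (1 : ℝ) • Ψ q) (s := Metric.ball 0 δ)
      (x := 0) (y := s n) (C := ε / 2)
      (fun r _ => ((hasDerivAt_iteratedFDeriv_ext f k hq0 r).add
        ((hasDerivAt_id r).smul_const (Ψ q))).hasDerivWithinAt)
      (fun r hr => by
        rw [one_smul, neg_add_eq_sub, norm_sub_rev]
        exact (h q hq r (by simpa using hr)).le)
      (convex_ball 0 δ) (Metric.mem_ball_self hδ) (by simpa using hn)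
    have e3 : -Ψ q - (s n)⁻¹ • (Φ (q - (s n, 0)) - Φ q) =
        -((s n)⁻¹ • (Φ (q - (s n, 0)) + s n • Ψ q - (Φ (q - (0, 0)) + (0 : ℝ) • Ψ q))) := by
      have : q - ((0 : ℝ), (0 : E3)) = q := by ext <;> simp
      rw [this, zero_smul, add_zero, smul_sub, smul_sub, smul_add, smul_smul,
        inv_mul_cancel₀ hn0, one_smul]
      abel
    rw [dist_eq_norm, e3, norm_neg, norm_smul, norm_inv]
    have hpos : 0 < ‖s n‖ := norm_pos_iff.2 hn0
    rw [sub_zero] at hmv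
    calc ‖s n‖⁻¹ * _ ≤ ‖s n‖⁻¹ * (ε / 2 * ‖s n‖) := by gcongr
      _ = ε / 2 := by field_simp
      _ < ε := half_lt_self hε

end TestFunctions

end NullInfinity

/-! ### Motion under the mass and translations -/

namespace NullInfinity

section Heisenberg

variable {H : Type*} [NormedAddCommGroup H] [InnerProductSpace ℂ H] {D : Submodule ℂ H}

theorem IsExponential.zero_apply {M : Module.End ℂ D} {W : ℝ → (H ≃ₗᵢ[ℂ] H)}
    (hW : IsExponential M W) (ψ : H) : W 0 ψ = ψ := by
  have h := hW.add 0 0 ψ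
  rw [add_zero] at h
  exact ((W 0).injective h).symm

theorem IsExponential.neg_apply {M : Module.End ℂ D} {W : ℝ → (H ≃ₗᵢ[ℂ] H)}
    (hW : IsExponential M W) (t : ℝ) (ψ : H) : W t (W (-t) ψ) = ψ := by
  rw [← hW.add, add_neg_cancel, hW.zero_apply]

/-- The derivative of `exp (i t M) ψ` is `i M exp (i t M) ψ`, if the group preserves the domain. -/
theorem IsExponential.hasDerivAt_of_mem {M : Module.End ℂ D} {W : ℝ → (H ≃ₗᵢ[ℂ] H)}
    (hW : IsExponential M W) {ψ : D} {t : ℝ} (ht : W t ψ ∈ D) :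
    HasDerivAt (fun t => W t (ψ : H)) (Complex.I • (M ⟨W t ψ, ht⟩ : H)) t := by
  have h := hW.hasDerivAt ⟨W t ψ, ht⟩
  rw [← sub_self t] at h
  refine (h.comp_sub_const t t).congr_of_eventuallyEq (Eventually.of_forall fun s => ?_)
  change W s ψ = W (s - t) (W t ψ)
  rw [← hW.add, sub_add_cancel]

/-- The derivative of `exp (i t M) ψ` is also `exp (i t M) i M ψ`. -/
theorem IsExponential.hasDerivAt_apply {M : Module.End ℂ D} {W : ℝ → (H ≃ₗᵢ[ℂ] H)}
    (hW : IsExponential M W) (ψ : D) (t : ℝ) :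
    HasDerivAt (fun t => W t (ψ : H)) (W t ((Complex.I • M ψ : D) : H)) t := by
  have h := hW.hasDerivAt ψ
  rw [← sub_self t] at h
  have h2 := (((W t).toContinuousLinearEquiv.toContinuousLinearMap.restrictScalars
    ℝ).hasFDerivAt).comp_hasDerivAt t (h.comp_sub_const t t)
  refine h2.congr_of_eventuallyEq (Eventually.of_forall fun s => ?_)
  change W s ψ = W t (W (s - t) ψ)
  rw [← hW.add, add_sub_cancel]

theorem IsExponential.apply_smul {M : Module.End ℂ D} {W : ℝ → (H ≃ₗᵢ[ℂ] H)}
    (hW : IsExponential M W) {ψ : D} {t : ℝ} (ht : W t ψ ∈ D) :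
    W t ((Complex.I • M ψ : D) : H) = Complex.I • (M ⟨W t ψ, ht⟩ : H) :=
  (hW.hasDerivAt_apply ψ t).unique (hW.hasDerivAt_of_mem ht)

/-- Two unitary groups whose generators extend `M` coincide, if one of them preserves the domain:
`exp (-i t M) exp (i t M) ψ` has derivative zero. -/
theorem IsExponential.eq_of_mem (hD : Dense (D : Set H)) {M : Module.End ℂ D}
    {W W' : ℝ → (H ≃ₗᵢ[ℂ] H)} (hW : IsExponential M W) (hW' : IsExponential M W')
    (hWD : ∀ (t : ℝ) (ψ : D), W t ψ ∈ D) (t : ℝ) : W' t = W t := by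
  have key : ∀ ψ : D, W' t (ψ : H) = W t ψ := by
    intro ψ
    let z : ℝ → H := fun t => W' (-t) (W t ψ)
    have hz : ∀ t, HasDerivAt z 0 t := by
      intro t
      have h1 := (hW.hasDerivAt ⟨W t ψ, hWD t ψ⟩).sub (hW'.hasDerivAt ⟨W t ψ, hWD t ψ⟩)
      rw [sub_self, hasDerivAt_iff_isLittleO_nhds_zero] at h1
      rw [hasDerivAt_iff_isLittleO_nhds_zero]
      refine Asymptotics.IsLittleO.of_norm_left ((h1.norm_left).congr_left fun s => ?_)
      have h2 : W (t + s) ψ = W s (W t ψ) := by rw [← hW.add, add_comm]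
      have h3 : W' (-t) (W t ψ) = W' (-(t + s)) (W' s (W t ψ)) := by
        rw [← hW'.add]
        congr 2
        ring
      simp only [z, Pi.sub_apply, zero_add, smul_zero, sub_zero, hW.zero_apply, hW'.zero_apply,
        sub_self]
      rw [h2, h3, ← map_sub, LinearIsometryEquiv.norm_map]
    have h4 : z t = z 0 := is_const_of_deriv_eq_zero (fun t => (hz t).differentiableAt)
      (fun t => (hz t).deriv) t 0
    simp only [z, neg_zero, hW.zero_apply, hW'.zero_apply] at h4
    have h5 := congrArg (W' t) h4
    rw [hW'.neg_apply] at h5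
    exact h5.symm
  ext x
  exact congrFun ((W' t).continuous.ext_on hD (W t).continuous fun ψ hψ => key ⟨ψ, hψ⟩) x

variable {V : Type*} [NormedAddCommGroup V] [NormedSpace ℝ V] {𝒱 : S2 → Submodule ℝ V}

/-- The vector `X(f) W_t ψ` depends jointly sequentially continuously on `f` and `t`. -/
def JointlyContinuous (X : TestSec 𝒱 →ₗ[ℝ] Module.End ℂ D) (W : ℝ → (H ≃ₗᵢ[ℂ] H))
    (hWD : ∀ (t : ℝ) (ψ : D), W t ψ ∈ D) : Prop :=
  ∀ (f : ℕ → TestSec 𝒱) (f₀ : TestSec 𝒱) (t : ℕ → ℝ) (t₀ : ℝ),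
    TestTendsto f f₀ → Tendsto t atTop (𝓝 t₀) → ∀ ψ : D,
      Tendsto (fun n => (X (f n) ⟨W (t n) ψ, hWD (t n) ψ⟩ : H)) atTop
        (𝓝 (X f₀ ⟨W t₀ ψ, hWD t₀ ψ⟩ : H))

variable {X : TestSec 𝒱 →ₗ[ℝ] Module.End ℂ D} {M : Module.End ℂ D} {W : ℝ → (H ≃ₗᵢ[ℂ] H)}
  {hWD : ∀ (t : ℝ) (ψ : D), W t ψ ∈ D}

theorem JointlyContinuous.continuous (hc : JointlyContinuous X W hWD) (f : TestSec 𝒱) (ψ : D) :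
    Continuous fun t => (X f ⟨W t ψ, hWD t ψ⟩ : H) :=
  continuous_iff_continuousAt.2 fun t₀ => tendsto_of_seq_tendsto fun t ht =>
    hc (fun _ => f) f t t₀ (testTendsto_const f) ht ψ

/-- Although `X(f)` is unbounded, `X(f) exp (i t M) ψ` is differentiable in `t`: against vectors of
the domain it has the continuous derivative `X(f) exp (i t M) i M ψ`. -/
theorem JointlyContinuous.hasDerivAt_apply [CompleteSpace H] (hD : Dense (D : Set H))
    (hX : ∀ f, IsHermitian (X f)) (hW : IsExponential M W) (hc : JointlyContinuous X W hWD)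
    (f : TestSec 𝒱) (ψ : D) (t : ℝ) :
    HasDerivAt (fun t => (X f ⟨W t ψ, hWD t ψ⟩ : H))
      (X f ⟨W t (Complex.I • M ψ : D), hWD t _⟩ : H) t := by
  set y : ℝ → H := fun t => (X f ⟨W t ψ, hWD t ψ⟩ : H) with hy
  set z : ℝ → H := fun t => (X f ⟨W t (Complex.I • M ψ : D), hWD t _⟩ : H) with hz
  have hzc : Continuous z := hc.continuous f _
  -- `y` is the primitive of `z`, since their matrix elements against the dense domain say so.
  have hw : ∀ t, HasDerivAt (fun t => y 0 + ∫ s in (0 : ℝ)..t, z s) (z t) t := fun t =>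
    (intervalIntegral.integral_hasDerivAt_right (hzc.intervalIntegrable _ _)
      hzc.stronglyMeasurable.stronglyMeasurableAtFilter hzc.continuousAt).const_add _
  have hyw : y = fun t => y 0 + ∫ s in (0 : ℝ)..t, z s := by
    funext t
    refine hD.eq_of_inner_right ℂ fun η hη => ?_
    have h1 : ∀ t, HasDerivAt (fun t => ⟪η, y t⟫_ℂ) ⟪η, z t⟫_ℂ t := by
      intro t
      have h2 := (hasDerivAt_const t ((X f ⟨η, hη⟩ : D) : H)).inner ℂ (hW.hasDerivAt_apply ψ t)
      rw [inner_zero_left, add_zero] at h2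
      have h3 : ⟪((X f ⟨η, hη⟩ : D) : H), W t (Complex.I • M ψ : D)⟫_ℂ = ⟪η, z t⟫_ℂ :=
        hX f ⟨η, hη⟩ ⟨W t (Complex.I • M ψ : D), hWD t _⟩
      rw [h3] at h2
      exact h2.congr_of_eventuallyEq
        (Eventually.of_forall fun s => (hX f ⟨η, hη⟩ ⟨W s ψ, hWD s ψ⟩).symm)
    have h4 : ∀ t, HasDerivAt (fun t => ⟪η, y t⟫_ℂ - ⟪η, y 0 + ∫ s in (0 : ℝ)..t, z s⟫_ℂ) 0 t := by
      intro t
      have h5 := (h1 t).sub ((hasDerivAt_const t η).inner ℂ (hw t))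
      rw [inner_zero_left, add_zero, sub_self] at h5
      exact h5
    have h6 := is_const_of_deriv_eq_zero (fun t => (h4 t).differentiableAt)
      (fun t => (h4 t).deriv) t 0
    simpa only [intervalIntegral.integral_same, add_zero, sub_self, sub_eq_zero] using h6
  have h7 := hw t
  rw [← hyw] at h7
  exact h7

/-- The product rule for `X(f_t) exp (i t M) ψ`, `f_t` being `f` translated by `κ t`. -/
theorem JointlyContinuous.hasDerivAt_shift [FiniteDimensional ℝ V] [CompleteSpace H]
    (hD : Dense (D : Set H)) (hX : ∀ f, IsHermitian (X f)) (hW : IsExponential M W)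
    (hc : JointlyContinuous X W hWD) {κ : ℝ} (hκ : κ ≠ 0) (f : TestSec 𝒱) (ψ : D) (t : ℝ) :
    HasDerivAt (fun t => (X (shift (κ * t) f) ⟨W t ψ, hWD t ψ⟩ : H))
      (-(κ • (X (dU (shift (κ * t) f)) ⟨W t ψ, hWD t ψ⟩ : H)) +
        (X (shift (κ * t) f) ⟨W t (Complex.I • M ψ : D), hWD t _⟩ : H)) t := by
  set g := shift (κ * t) f with hg
  rw [hasDerivAt_iff_tendsto_slope_zero]
  refine tendsto_of_seq_tendsto fun s hs => ?_
  obtain ⟨hs1, hs2⟩ := tendsto_nhdsWithin_iff.1 hs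
  have h1 := (hasDerivAt_iff_tendsto_slope_zero.1 (hc.hasDerivAt_apply hD hX hW g ψ t)).comp hs
  have hκs : Tendsto (fun n => κ * s n) atTop (𝓝 0) := by simpa using hs1.const_mul κ
  have h2 := hc _ _ (fun n => t + s n) t (testTendsto_slope_shift g hκs
    (hs2.mono fun n hn => mul_ne_zero hκ hn)) (by simpa using hs1.const_add t) ψ
  have h3 := (h2.const_smul κ).add h1
  have h4 : κ • ((X (-dU g) ⟨W t ψ, hWD t ψ⟩ : D) : H) =
      -(κ • (X (dU g) ⟨W t ψ, hWD t ψ⟩ : H)) := by simp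
  rw [h4] at h3
  refine h3.congr' (hs2.mono fun n hn => ?_)
  have hn0 : s n ≠ 0 := hn
  have h5 : shift (κ * (t + s n)) f = shift (κ * s n) g := by
    rw [hg, shift_shift]
    congr 1
    ring
  have h6 : κ • (κ * s n)⁻¹ = (s n)⁻¹ := by
    rw [smul_eq_mul]
    field_simp
  simp only [Function.comp_apply, h5, map_smul, map_sub, LinearMap.smul_apply,
    LinearMap.sub_apply, Submodule.coe_sub, Submodule.coe_smul_of_tower, smul_smul, ← hg]
  rw [← smul_eq_mul κ, h6, ← smul_add, sub_add_sub_cancel]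

/-- The generator `-i [M, X(f)] - κ X(∂_u f)` of the motion `t ↦ exp (-i t M) X(f_t) exp (i t M)`,
where `f_t` is `f` translated by `κ t`. The scalar `-i` is factored out, so that the bracket becomes
the correction to the commutator of `M` and `X(f)`. -/
noncomputable def motionGenerator [FiniteDimensional ℝ V] (M : Module.End ℂ D)
    (X : TestSec 𝒱 →ₗ[ℝ] Module.End ℂ D) (κ : ℝ) (f : TestSec 𝒱) : Module.End ℂ D :=
  (-Complex.I) • (⁅M, X f⁆ - ((κ : ℂ) * Complex.I) • X (dU f))

/-- The equation of motion for matrix elements of `B X(f_t)`. The vector `B X(f_t) exp (i t M) ψ`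
need not lie in the domain, so weak commutation of `B` with `M` is used to move `M` across `B`. -/
theorem JointlyContinuous.hasDerivAt_inner [FiniteDimensional ℝ V] [CompleteSpace H]
    (hD : Dense (D : Set H)) (hX : ∀ f, IsHermitian (X f)) (hW : IsExponential M W)
    (hc : JointlyContinuous X W hWD) {κ : ℝ} (hκ : κ ≠ 0) {B : H →L[ℂ] H}
    (hB : WeaklyCommutes B M) (f : TestSec 𝒱) (φ ψ : D) (t : ℝ) :
    HasDerivAt (fun t => ⟪W t (φ : H), B (X (shift (κ * t) f) ⟨W t ψ, hWD t ψ⟩ : D)⟫_ℂ)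
      ⟪W t (φ : H), B (motionGenerator M X κ (shift (κ * t) f) ⟨W t ψ, hWD t ψ⟩ : D)⟫_ℂ t := by
  have h1 := (hW.hasDerivAt_of_mem (hWD t φ)).inner ℂ
    (((B.restrictScalars ℝ).hasFDerivAt).comp_hasDerivAt t
      (hc.hasDerivAt_shift hD hX hW hκ f ψ t))
  refine h1.congr_deriv ?_
  set g := shift (κ * t) f
  set φt : D := ⟨W t φ, hWD t φ⟩ with hφ
  set ψt : D := ⟨W t ψ, hWD t ψ⟩ with hψ
  have h2 : (⟨W t (Complex.I • M ψ : D), hWD t _⟩ : D) = Complex.I • M ψt :=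
    Subtype.ext (hW.apply_smul (hWD t ψ))
  have h3 : W t (φ : H) = (φt : H) := rfl
  rw [h2, h3, inner_smul_left]
  simp only [Function.comp_apply, ContinuousLinearMap.coe_restrictScalars']
  rw [hB φt (X g ψt)]
  simp only [motionGenerator, LinearMap.smul_apply, LinearMap.sub_apply, Ring.lie_def,
    Module.End.mul_apply, Submodule.coe_smul, Submodule.coe_sub, map_smul, map_sub, map_add,
    map_neg, inner_add_right, inner_sub_right, inner_smul_right, inner_neg_right,
    ← Complex.coe_smul, Complex.conj_I]
  linear_combination -(κ : ℂ) * ⟪(φt : H), B (X (dU g) ψt : D)⟫_ℂ * Complex.I_mul_I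

/-- If `B` commutes with the generator of the motion `t ↦ exp (-i t M) X(f_t) exp (i t M)`, then it
commutes with `X(f)` as soon as it commutes with `X(f_t)` at an earlier time. -/
theorem JointlyContinuous.weaklyCommutes_of_shift [FiniteDimensional ℝ V] [CompleteSpace H]
    (hD : Dense (D : Set H)) (hX : ∀ f, IsHermitian (X f)) (hW : IsExponential M W)
    (hc : JointlyContinuous X W hWD) {κ : ℝ} (hκ : κ ≠ 0) {B : H →L[ℂ] H}
    (hB : WeaklyCommutes B M) {f : TestSec 𝒱} {t₀ : ℝ} (ht₀ : t₀ ≤ 0)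
    (hgen : ∀ t ∈ Set.Icc t₀ 0, WeaklyCommutes B (motionGenerator M X κ (shift (κ * t) f)))
    (h₀ : WeaklyCommutes B (X (shift (κ * t₀) f))) : WeaklyCommutes B (X f) := by
  intro φ ψ
  -- The matrix element of the commutator of `B` with `X(f_t)`; its first term is written through
  -- the adjoint of `B`, so that the equation of motion applies to both terms.
  let F : ℝ → ℂ := fun t => star ⟪W t (ψ : H), star B (X (shift (κ * t) f) ⟨W t φ, hWD t φ⟩ : D)⟫_ℂ
    - ⟪W t (φ : H), B (X (shift (κ * t) f) ⟨W t ψ, hWD t ψ⟩ : D)⟫_ℂ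
  have hadj : ∀ x y : H, star ⟪x, star B y⟫_ℂ = ⟪y, B x⟫_ℂ := by
    intro x y
    rw [RCLike.star_def, inner_conj_symm, ContinuousLinearMap.star_eq_adjoint,
      ContinuousLinearMap.adjoint_inner_left]
  have hF : ∀ t ∈ Set.Icc t₀ 0, HasDerivAt F 0 t := by
    intro t ht
    have h1 := (hc.hasDerivAt_inner hD hX hW hκ hB.star_left f ψ φ t).star.sub
      (hc.hasDerivAt_inner hD hX hW hκ hB f φ ψ t)
    rw [hadj, hgen t ht ⟨W t φ, hWD t φ⟩ ⟨W t ψ, hWD t ψ⟩, sub_self] at h1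
    exact h1
  have h1 := constant_of_has_deriv_right_zero
    (fun t ht => (hF t ht).continuousAt.continuousWithinAt)
    (fun t ht => (hF t (Set.Ico_subset_Icc_self ht)).hasDerivWithinAt) 0 ⟨ht₀, le_rfl⟩
  have h2 : F t₀ = 0 := by
    simp only [F]
    rw [hadj, h₀ ⟨W t₀ φ, hWD t₀ φ⟩ ⟨W t₀ ψ, hWD t₀ ψ⟩, sub_self]
  rw [h2] at h1
  simp only [F, hadj, mul_zero, shift_zero, hW.zero_apply] at h1
  exact sub_eq_zero.1 h1

/-- If the generator of the motion vanishes, `X(f_t) = exp (i t M) X(f) exp (-i t M)`. -/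
theorem JointlyContinuous.shift_apply_eq [FiniteDimensional ℝ V] [CompleteSpace H]
    (hD : Dense (D : Set H)) (hX : ∀ f, IsHermitian (X f)) (hM : IsHermitian M)
    (hW : IsExponential M W) (hc : JointlyContinuous X W hWD) {κ : ℝ} (hκ : κ ≠ 0)
    {f : TestSec 𝒱} {t : ℝ} (ht : 0 ≤ t)
    (hgen : ∀ s ∈ Set.Icc 0 t, motionGenerator M X κ (shift (κ * s) f) = 0) (ψ : D) :
    (X (shift (κ * t) f) ψ : H) = W t (X f ⟨W (-t) ψ, hWD _ ψ⟩ : D) := by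
  have hB : WeaklyCommutes (ContinuousLinearMap.id ℂ H) M := hM
  refine hD.eq_of_inner_right ℂ fun η hη => ?_
  let F : ℝ → ℂ := fun s => ⟪W s (W (-t) η), (X (shift (κ * s) f)
    ⟨W s (W (-t) ψ), hWD s ⟨W (-t) ψ, hWD _ ψ⟩⟩ : H)⟫_ℂ
  have hF : ∀ s ∈ Set.Icc 0 t, HasDerivAt F 0 s := fun s hs => by
    have h1 := hc.hasDerivAt_inner hD hX hW hκ hB f ⟨W (-t) η, hWD _ ⟨η, hη⟩⟩
      ⟨W (-t) ψ, hWD _ ψ⟩ s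
    rw [hgen s hs] at h1
    simpa using h1
  have h1 := constant_of_has_deriv_right_zero
    (fun s hs => (hF s hs).continuousAt.continuousWithinAt)
    (fun s hs => (hF s (Set.Ico_subset_Icc_self hs)).hasDerivWithinAt) t ⟨ht, le_rfl⟩
  simp only [F, mul_zero, shift_zero, hW.zero_apply, hW.neg_apply] at h1
  exact h1.trans (by
    rw [← LinearIsometryEquiv.inner_map_map (W t) (W (-t) η), hW.neg_apply])

end Heisenberg

end NullInfinity

/-! ### Propagation to the future -/

namespace NullInfinity

section Propagation

variable {V : Type*} [NormedAddCommGroup V] [NormedSpace ℝ V] {𝒱 : S2 → Submodule ℝ V}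

/-- An additive property of test sections that holds for those supported in `(a, b)`, and that
holds for `f` if it holds for the translate of `f` by some `r > 0` to the past that stays to the
future of a point `c` of `(a, b)`, holds for all test sections to the future
of `a`. -/
theorem of_suppIn_Ioi {P : TestSec 𝒱 → Prop} {a b c : ℝ} (hac : a < c) (hcb : c < b)
    (hadd : ∀ f g, P f → P g → P (f + g)) (hloc : ∀ f, SuppIn f (Set.Ioo a b) → P f)
    (hshift : ∀ f, ∀ r, 0 < r → SuppIn f (Set.Ioi (c + r)) → P (shift (-r) f) → P f)
    {f : TestSec 𝒱} (hf : SuppIn f (Set.Ioi a)) : P f := by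
  obtain ⟨r, hr, hb⟩ : ∃ r, 0 < r ∧ c + 4 * r = b := ⟨(b - c) / 4, by linarith, by ring⟩
  -- The cutoff is `0` before `c + 2 r` and `1` after `c + 3 r < b`: the part of `f` that it retains
  -- can be translated by `r` to the past, the other part is supported in `(a, b)`.
  let ρ : ℝ → ℝ := fun u => Real.smoothTransition (r⁻¹ * (u - (c + 2 * r)))
  have hρ : ContDiff ℝ ∞ ρ := Real.smoothTransition.contDiff.comp (by fun_prop)
  have hρ0 : ∀ u, u ≤ c + 2 * r → ρ u = 0 := fun u hu =>
    Real.smoothTransition.zero_of_nonpos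
      (mul_nonpos_of_nonneg_of_nonpos (inv_nonneg.2 hr.le) (by linarith))
  have hρ1 : ∀ u, c + 3 * r ≤ u → ρ u = 1 := fun u hu =>
    Real.smoothTransition.one_of_one_le (by
      rw [le_inv_mul_iff₀ hr]
      linarith)
  have key : ∀ n : ℕ, ∀ f : TestSec 𝒱, SuppIn f (Set.Ioo a (b + n * r)) → P f := by
    intro n
    induction n with
    | zero => exact fun f hf => hloc f (by simpa using hf)
    | succ n ih =>
      intro f hf
      push_cast at hf
      have hsplit : f = lineMul ρ hρ f + lineMul (fun u => 1 - ρ u) (contDiff_const.sub hρ) f := by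
        ext p
        change f.1 p = ρ p.1 • f.1 p + (1 - ρ p.1) • f.1 p
        rw [← add_smul, add_sub_cancel, one_smul]
      rw [hsplit]
      refine hadd _ _ ?_ (hloc _ ?_)
      · have h1 : SuppIn (lineMul ρ hρ f) (Set.Ico (c + 2 * r) (b + (n + 1) * r)) :=
          hf.lineMul hρ isClosed_Ici (fun u hu => hρ0 u (not_le.1 hu).le)
            fun u hu => ⟨hu.2, hu.1.2⟩
        refine hshift _ r hr (h1.mono fun u hu => ?_) (ih _ (h1.shift fun u hu => ?_))
        · exact lt_of_lt_of_le (by linarith) hu.1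
        · have h2 := hu.1
          have h3 := hu.2
          constructor <;> linarith
      · refine hf.lineMul _ isClosed_Iic (A := Set.Iic (c + 3 * r)) (fun u hu => ?_) fun u hu => ?_
        · rw [hρ1 u (not_le.1 hu).le, sub_self]
        · exact ⟨hu.1.1, lt_of_le_of_lt hu.2 (by linarith)⟩
  obtain ⟨T, hT⟩ := hf.exists_subset_Iio
  obtain ⟨n, hn⟩ := exists_nat_gt ((T - b) / r)
  rw [div_lt_iff₀ hr] at hn
  exact key n f (hT.mono fun u hu => ⟨hu.1, lt_trans hu.2 (by linarith)⟩)

/-- A test function of unit mass supported in a given interval. -/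
theorem exists_testLine {a b : ℝ} (hab : a < b) :
    ∃ χ : TestLine, (∫ u, χ.1 u) = 1 ∧ tsupport χ.1 ⊆ Set.Ioo a b := by
  let β : ContDiffBump ((a + b) / 2) := ⟨(b - a) / 8, (b - a) / 4, by linarith, by linarith⟩
  refine ⟨⟨β.normed volume, β.contDiff_normed, β.hasCompactSupport_normed⟩,
    β.integral_normed, ?_⟩
  rw [β.tsupport_normed_eq, Real.closedBall_eq_Icc]
  intro u hu
  have h1 := hu.1
  have h2 := hu.2
  simp only [β] at h1 h2
  constructor <;> linarith

theorem suppIn_ofLine {χ : TestLine} {s : Set ℝ} (hχ : tsupport χ.1 ⊆ s) :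
    SuppIn (ofLine χ) s := by
  have h : tsupport (ofLine χ).1 ⊆ Prod.fst ⁻¹' tsupport χ.1 :=
    closure_minimal (fun p hp => subset_tsupport χ.1 hp)
      ((isClosed_tsupport χ.1).preimage continuous_fst)
  exact h.trans (Set.preimage_mono hχ)

end Propagation

namespace AsymptoticTheory

variable {H : Type*} [NormedAddCommGroup H] [InnerProductSpace ℂ H] [CompleteSpace H]
  {ι : Type*} {T : AsymptoticTheory H ι}

theorem isEssSelfAdjoint_of_mem_radiativeFields {a b : ℝ} {A : Module.End ℂ T.D}
    (hA : A ∈ T.radiativeFields a b) : IsEssSelfAdjoint A := by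
  rcases hA with ⟨f, -, rfl⟩ | ⟨k, h, -, rfl⟩
  · exact T.C_selfAdjoint f
  · exact T.O_selfAdjoint k h

theorem isEssSelfAdjoint_of_mem_allFields {a b : ℝ} {A : Module.End ℂ T.D}
    (hA : A ∈ T.allFields a b) : IsEssSelfAdjoint A := by
  rcases hA with ⟨h, -, rfl⟩ | hA
  · exact T.mB_selfAdjoint h
  · exact isEssSelfAdjoint_of_mem_radiativeFields hA

section Motion

variable {V : Type*} [NormedAddCommGroup V] [NormedSpace ℝ V] [FiniteDimensional ℝ V]
  {𝒱 : S2 → Submodule ℝ V} {X : TestSec 𝒱 →ₗ[ℝ] Module.End ℂ T.D} {χ : TestLine} {c : ℝ}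

/-- When the mass is evaluated before the support of `f`, the generator of the joint motion under
the mass and translations is, up to a factor, the correction to the commutator. -/
theorem motionGenerator_mass (hχ : (∫ u, χ.1 u) = 1) (hc : tsupport χ.1 ⊆ Set.Iio c) (G : ℝ)
    {f : TestSec 𝒱} (hf : SuppIn f (Set.Ioi c)) :
    motionGenerator (T.mass χ) X (4 * Real.pi * G) f =
      (-Complex.I) • T.commutatorCorrection G X χ f := by
  rw [commutatorCorrection, stepMul_eq_self hχ hc hf]
  rfl

/-- The correction to the commutator is anti-Hermitian. -/
theorem commutatorCorrection_formalAdjoint (hX : ∀ f, IsHermitian (X f)) (G : ℝ)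
    (f : TestSec 𝒱) (φ ψ : T.D) :
    ⟪((-T.commutatorCorrection G X χ f) φ : H), (ψ : H)⟫_ℂ =
      ⟪(φ : H), (T.commutatorCorrection G X χ f ψ : H)⟫_ℂ := by
  have hM : IsHermitian (T.mass χ) := (T.mB_selfAdjoint _).1
  simp only [commutatorCorrection, LinearMap.neg_apply, LinearMap.smul_apply, LinearMap.sub_apply,
    Ring.lie_def, Module.End.mul_apply, Submodule.coe_neg, Submodule.coe_smul, Submodule.coe_sub,
    inner_sub_right, inner_smul_right, inner_sub_left, inner_smul_left, inner_neg_left, map_mul,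
    Complex.conj_I, Complex.conj_ofReal]
  rw [hM _ ψ, hX f _ ψ, hX f φ _, hM φ _, hX _ φ ψ]
  ring

/-- A bounded operator that commutes with all fields in `(a, b)` commutes with `X(f)` for every `f`
supported to the future of `a`, if the corrections to the commutators of `X` with the mass are
local: `X(f)` is moved into `(a, b)` by the mass. -/
theorem weaklyCommutes_of_mem_commutant {G : ℝ} (hG : 0 < G) {a b : ℝ} (hab : a < b)
    (hX : ∀ f, IsHermitian (X f))
    (hcont : ∀ χ : TestLine, ∃ (W : ℝ → (H ≃ₗᵢ[ℂ] H)) (hWD : ∀ (t : ℝ) (ψ : T.D), W t ψ ∈ T.D),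
      IsExponential (T.mass χ) W ∧ JointlyContinuous X W hWD)
    (hcomm : ∀ χ : TestLine, tsupport χ.1 ⊆ Set.Ioo a b → ∀ f,
      IsAffiliated (T.allFields a b) (T.commutatorCorrection G X χ f))
    {B : H →L[ℂ] H} (hB : B ∈ commutant (T.allFields a b))
    (hloc : ∀ f, SuppIn f (Set.Ioo a b) → WeaklyCommutes B (X f))
    {f : TestSec 𝒱} (hf : SuppIn f (Set.Ioi a)) : WeaklyCommutes B (X f) := by
  obtain ⟨c, hac, hcb⟩ := exists_between hab
  obtain ⟨χ, hχ, hsupp⟩ := exists_testLine hac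
  obtain ⟨W, hWD, hW, hc⟩ := hcont χ
  have hχab : tsupport χ.1 ⊆ Set.Ioo a b := hsupp.trans (Set.Ioo_subset_Ioo_right hcb.le)
  have hM : WeaklyCommutes B (T.mass χ) :=
    (hB _ (Or.inl ⟨_, suppIn_ofLine hχab, rfl⟩)).1.weaklyCommutes (T.mB_selfAdjoint _).1
  have hκ : 0 < 4 * Real.pi * G := by positivity
  refine of_suppIn_Ioi (P := fun f => WeaklyCommutes B (X f)) hac hcb (fun f g hf hg => ?_) hloc
    (fun f r hr hf h => ?_) hf
  · rw [map_add]
    exact hf.add hg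
  · refine hc.weaklyCommutes_of_shift T.dense hX hW hκ.ne' hM (t₀ := -r / (4 * Real.pi * G))
      (div_nonpos_of_nonpos_of_nonneg (by linarith) hκ.le) (fun t ht => ?_) ?_
    · have hs : SuppIn (shift (4 * Real.pi * G * t) f) (Set.Ioi c) := by
        refine hf.shift fun u hu => ?_
        have h1 := (div_le_iff₀' hκ).1 ht.1
        have h2 : c + r < u - 4 * Real.pi * G * t := hu
        have h3 := mul_nonpos_of_nonneg_of_nonpos hκ.le ht.2
        change c < u
        linarith
      rw [motionGenerator_mass hχ (hsupp.trans Set.Ioo_subset_Iio_self) G hs]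
      intro φ ψ
      have h1 := (hcomm χ hχab (shift (4 * Real.pi * G * t) f) B hB).inner_eq
        (commutatorCorrection_formalAdjoint hX G _) φ ψ
      simp only [LinearMap.neg_apply, Submodule.coe_neg, inner_neg_left] at h1
      simp only [LinearMap.smul_apply, Submodule.coe_smul, map_smul, inner_smul_left,
        inner_smul_right, map_neg, Complex.conj_I]
      rw [← h1]
      ring
    · rw [mul_div_cancel₀ _ hκ.ne']
      exact h

/-- If the corrections vanish to the future of `c`, the mass generates translations there. -/
theorem isMassConjugate_shift {G : ℝ} (hG : 0 < G) (hX : ∀ f, IsHermitian (X f))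
    (hcont : ∃ (W : ℝ → (H ≃ₗᵢ[ℂ] H)) (hWD : ∀ (t : ℝ) (ψ : T.D), W t ψ ∈ T.D),
      IsExponential (T.mass χ) W ∧ JointlyContinuous X W hWD)
    (hχ : (∫ u, χ.1 u) = 1) (hχc : tsupport χ.1 ⊆ Set.Iio c)
    (hcomm : ∀ f, SuppIn f (Set.Ioi c) → T.commutatorCorrection G X χ f = 0) {U : ℝ} (hU : 0 < U)
    {f : TestSec 𝒱} (hf : SuppIn f (Set.Ioi c)) :
    T.IsMassConjugate G χ U (X f) (X (shift U f)) := by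
  intro W' hW'
  obtain ⟨W, hWD, hW, hc⟩ := hcont
  have hWW' : W' = W := funext fun t => hW.eq_of_mem T.dense hW' hWD t
  subst hWW'
  have hκ : 0 < 4 * Real.pi * G := by positivity
  refine ⟨hWD, fun ψ => ?_⟩
  have hM : IsHermitian (T.mass χ) := (T.mB_selfAdjoint _).1
  have h1 := hc.shift_apply_eq T.dense hX hM hW hκ.ne' (f := f)
    (t := U / (4 * Real.pi * G)) (by positivity) (fun s hs => ?_) ψ
  · rw [mul_div_cancel₀ _ hκ.ne'] at h1
    simp only [neg_div]
    exact h1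
  · have h2 : SuppIn (shift (4 * Real.pi * G * s) f) (Set.Ioi c) := by
      refine hf.shift fun u hu => ?_
      have h2 : c < u - 4 * Real.pi * G * s := hu
      have h3 := mul_nonneg hκ.le hs.1
      change c < u
      linarith
    rw [motionGenerator_mass hχ hχc G h2, hcomm _ h2, smul_zero]

end Motion

theorem exists_exponential_C (T : AsymptoticTheory H ι) (χ : TestLine) :
    ∃ (W : ℝ → (H ≃ₗᵢ[ℂ] H)) (hWD : ∀ (t : ℝ) (ψ : T.D), W t ψ ∈ T.D),
      IsExponential (T.mass χ) W ∧ JointlyContinuous T.C W hWD := by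
  obtain ⟨W, hW, hWD, hC, -⟩ := T.exp_mass χ
  exact ⟨W, hWD, hW, hC⟩

theorem exists_exponential_O (T : AsymptoticTheory H ι) (k : ι) (χ : TestLine) :
    ∃ (W : ℝ → (H ≃ₗᵢ[ℂ] H)) (hWD : ∀ (t : ℝ) (ψ : T.D), W t ψ ∈ T.D),
      IsExponential (T.mass χ) W ∧ JointlyContinuous (T.O k) W hWD := by
  obtain ⟨W, hW, hWD, -, hO⟩ := T.exp_mass χ
  exact ⟨W, hWD, hW, hO k⟩

/-- By the constraint, an operator that commutes with the radiative data commutes with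
`∂_u m_B`. -/
theorem MassConstraint.weaklyCommutes_mB_dU {G : ℝ} (hconstr : T.MassConstraint G) {a b : ℝ}
    {B : H →L[ℂ] H} (hB : B ∈ commutant (T.radiativeFields a b)) {h : TestScalar}
    (hh : SuppIn h (Set.Ioo a b)) : WeaklyCommutes B (T.mB (dU h)) := by
  obtain ⟨NN, Tuu, L, hNN, hT, hL, hEq⟩ := hconstr
  have hC : ∀ f, SuppIn f (Set.Ioo a b) → WeaklyCommutes B (T.C f) := fun f hf =>
    (hB _ (Or.inl ⟨f, hf, rfl⟩)).1.weaklyCommutes (T.C_selfAdjoint f).1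
  have hN : ∀ f, SuppIn f (Set.Ioo a b) → WeaklyCommutes B (T.news f) := fun f hf =>
    (hC _ hf.dU).neg
  have hNNh : WeaklyCommutes B (NN h) := by
    obtain ⟨m, f, g, c, hfg, -, hlim⟩ := hNN h a b hh
    exact .of_tendsto_symmetrized (fun n i => hN _ (hfg n i).1) (fun n i => hN _ (hfg n i).2) hlim
  have hTh : WeaklyCommutes B (Tuu h) :=
    ((hT h).2 a b hh B fun A hA => hB A (Or.inr hA)).weaklyCommutes (hT h).1
  have hLh : WeaklyCommutes B (L h) := ((hL h).2 a b hh B hB).weaklyCommutes (hL h).1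
  have h1 : WeaklyCommutes B (-T.mB (dU h)) := by
    rw [hEq h]
    exact ((((hC _ hh.dU.hessTF).real_smul _).neg.sub (hNNh.real_smul _)).sub
      (hTh.real_smul _)).add hLh
  simpa using h1.neg

/-- An operator that commutes with `∂_u m_B` to the future of `a`, and with `m_B` in `(a, b)`,
commutes with `m_B` to the future of `a`. -/
theorem weaklyCommutes_mB {a b : ℝ} (hab : a < b) {B : H →L[ℂ] H}
    (hdU : ∀ h, SuppIn h (Set.Ioi a) → WeaklyCommutes B (T.mB (dU h)))
    (hloc : ∀ h, SuppIn h (Set.Ioo a b) → WeaklyCommutes B (T.mB h))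
    {h : TestScalar} (hh : SuppIn h (Set.Ioi a)) : WeaklyCommutes B (T.mB h) := by
  obtain ⟨c, hac, hcb⟩ := exists_between hab
  have hX : ∀ h, IsHermitian (T.mB h) := fun h => (T.mB_selfAdjoint h).1
  -- Here translations alone are used, that is, the trivial unitary group.
  have hW : IsExponential (0 : Module.End ℂ T.D) (fun _ => LinearIsometryEquiv.refl ℂ H) :=
    ⟨fun _ _ _ => rfl, fun _ => continuous_const, fun ψ => by
      simpa using hasDerivAt_const (0 : ℝ) (ψ : H)⟩
  have hc : JointlyContinuous T.mB (fun _ => LinearIsometryEquiv.refl ℂ H) (fun _ ψ => ψ.2) :=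
    fun f f₀ _ _ hf _ ψ => T.mB_continuous f f₀ hf ψ
  refine of_suppIn_Ioi (P := fun f => WeaklyCommutes B (T.mB f)) hac hcb (fun f g hf hg => ?_) hloc
    (fun f r hr hf h => ?_) hh
  · rw [map_add]
    exact hf.add hg
  · refine hc.weaklyCommutes_of_shift T.dense hX hW one_ne_zero (fun φ ψ => by simp) (t₀ := -r)
      (by linarith) (fun t ht => ?_) ?_
    · have hs : SuppIn (shift (1 * t) f) (Set.Ioi a) := by
        refine hf.shift fun u hu => ?_
        have h1 := ht.1
        have h2 : c + r < u - 1 * t := hu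
        change a < u
        linarith
      have h1 : motionGenerator (0 : Module.End ℂ T.D) T.mB 1 (shift (1 * t) f) =
          -T.mB (dU (shift (1 * t) f)) := by
        simp [motionGenerator, Ring.lie_def, smul_smul]
      rw [h1]
      exact (hdU _ hs).neg
    · rw [one_mul]
      exact h

/-- Fields in an interval determine all fields to its future: their commutant is contained in the
commutant of the latter. -/
theorem commutant_allFields_subset {G : ℝ} (hG : 0 < G) (hcomm : T.MassCommutators G)
    (hconstr : T.MassConstraint G) {a b a' b' : ℝ} (hab : a < b) (haa' : a ≤ a') :
    commutant (T.allFields a b) ⊆ commutant (T.allFields a' b') := by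
  intro B hB
  have hC : ∀ f, SuppIn f (Set.Ioi a) → WeaklyCommutes B (T.C f) := fun f hf =>
    weaklyCommutes_of_mem_commutant hG hab (fun f => (T.C_selfAdjoint f).1) T.exists_exponential_C
      (fun χ hχ => (hcomm χ a b hχ).1) hB
      (fun f hf => (hB _ (Or.inr (Or.inl ⟨f, hf, rfl⟩))).1.weaklyCommutes (T.C_selfAdjoint f).1) hf
  have hO : ∀ k h, SuppIn h (Set.Ioi a) → WeaklyCommutes B (T.O k h) := fun k h hh =>
    weaklyCommutes_of_mem_commutant hG hab (fun h => (T.O_selfAdjoint k h).1)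
      (T.exists_exponential_O k) (fun χ hχ => (hcomm χ a b hχ).2 k) hB
      (fun h hh => (hB _ (Or.inr (Or.inr ⟨k, h, hh, rfl⟩))).1.weaklyCommutes
        (T.O_selfAdjoint k h).1) hh
  have hrad : ∀ T₀ : ℝ, B ∈ commutant (T.radiativeFields a T₀) := fun T₀ => by
    rw [mem_commutant_iff T.dense fun A hA => isEssSelfAdjoint_of_mem_radiativeFields hA]
    rintro A (⟨f, hf, rfl⟩ | ⟨k, h, hh, rfl⟩)
    · exact hC f (hf.mono Set.Ioo_subset_Ioi_self)
    · exact hO k h (hh.mono Set.Ioo_subset_Ioi_self)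
  have hmB : ∀ h, SuppIn h (Set.Ioi a) → WeaklyCommutes B (T.mB h) := fun h hh => by
    refine weaklyCommutes_mB hab (fun h hh => ?_) (fun h hh => ?_) hh
    · obtain ⟨T₀, hT₀⟩ := hh.exists_subset_Iio
      exact hconstr.weaklyCommutes_mB_dU (hrad T₀) hT₀
    · exact (hB _ (Or.inl ⟨h, hh, rfl⟩)).1.weaklyCommutes (T.mB_selfAdjoint h).1
  have hsub : Set.Ioo a' b' ⊆ Set.Ioi a := fun u hu => haa'.trans_lt hu.1
  rw [mem_commutant_iff T.dense fun A hA => isEssSelfAdjoint_of_mem_allFields hA]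
  rintro A (⟨h, hh, rfl⟩ | ⟨f, hf, rfl⟩ | ⟨k, h, hh, rfl⟩)
  · exact hmB h (hh.mono hsub)
  · exact hC f (hf.mono hsub)
  · exact hO k h (hh.mono hsub)

end AsymptoticTheory

end NullInfinity

theorem mainTheorem3 {H : Type*} [NormedAddCommGroup H] [InnerProductSpace ℂ H] [CompleteSpace H]
    {ι : Type*} (T : NullInfinity.AsymptoticTheory H ι) (G : ℝ) (hG : 0 < G)
    (hcomm : T.MassCommutators G) (hconstr : T.MassConstraint G) :
    (∀ u₁ u₂ : ℝ, u₂ < u₁ → ∀ ε₁ ε₂ : ℝ, 0 < ε₁ → 0 < ε₂ → ∀ ρ σ : NullInfinity.State H,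
      NullInfinity.Distinguishable (T.cutAlgebra u₁ ε₁) ρ σ →
        NullInfinity.Distinguishable (T.cutAlgebra u₂ ε₂) ρ σ) ∧
    (T.ContactCorrections G → ∀ (χ : NullInfinity.TestLine) (c U : ℝ),
      (∫ u, χ.1 u) = 1 → tsupport χ.1 ⊆ Set.Iio c → 0 < U →
      (∀ f : NullInfinity.TestTensor, NullInfinity.SuppIn f (Set.Ioi c) →
        T.IsMassConjugate G χ U (T.C f) (T.C (NullInfinity.shift U f))) ∧
      ∀ (k : ι) (h : NullInfinity.TestScalar), NullInfinity.SuppIn h (Set.Ioi c) →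
        T.IsMassConjugate G χ U (T.O k h) (T.O k (NullInfinity.shift U h))) := by
  refine ⟨fun u₁ u₂ hu ε₁ ε₂ _ hε₂ ρ σ ⟨A, hA, hne⟩ => ⟨A, ?_, hne⟩,
    fun hcontact χ c U hχ hχc hU => ⟨fun f hf => ?_, fun k h hh => ?_⟩⟩
  · exact NullInfinity.generatedAlgebra_mono
      (T.commutant_allFields_subset hG hcomm hconstr (lt_add_of_pos_right u₂ hε₂) hu.le) hA
  · exact T.isMassConjugate_shift hG (fun f => (T.C_selfAdjoint f).1) (T.exists_exponential_C χ)
      hχ hχc (hcontact χ c hχc).1 hU hf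
  · exact T.isMassConjugate_shift hG (fun h => (T.O_selfAdjoint k h).1)
      (T.exists_exponential_O k χ) hχ hχc ((hcontact χ c hχc).2 k) hU hh
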